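/- **Theorem (error bound for the bias of averaged SGD for random features regression).** *Setting.* Let $n,m,d\ge 1$, let $\rho$ be a Borel probability measure on $\mathbb R^d\times\mathbb R$ with $\int y^2\,d\rho<\infty$ and marginal $\rho_X$ on $\mathbb R^d$, and let $\sigma:\mathbb R\to\mathbb R$. Let $W\in\mathbb R^{m\times d}$ have i.i.d. $\mathcal N(0,1)$ entries, independent of the i.i.d. sample $(x_1,y_1),\dots,(x_n,y_n)\sim\rho$. Put $\varphi(x)=\frac1{\sqrt m}\sigma(Wx/\sqrt d)\in\mathbb R^m$ ($\sigma$ applied entrywise), $\Sigma_m=\mathbb E_{x\sim\rho_X}[\varphi(x)\varphi(x)^\top]$, $\widetilde\Sigma_m=\mathbb E_W[\Sigma_m]$, $\Sigma_d=\mathbb E_{x\sim\rho_X}[xx^\top]$. Let $f^*=f^*(W)\in\mathbb R^m$ be the least-norm minimizer of $\theta\mapsto\int(\langle\theta,\varphi(x)\rangle-y)^2\,d\rho$; its Euclidean norm is the Hilbert norm of the best predictor in the random features space. One-pass SGD $\theta_t=\theta_{t-1}+\gamma_t(y_t-\langle\theta_{t-1},\varphi(x_t)\rangle)\varphi(x_t)$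 with step size $\gamma_t=\gamma_0t^{-\zeta}$ and iterate averaging has the bias iterates $$\eta_t=[I-\gamma_t\varphi(x_t)\varphi(x_t)^\top]\,\eta_{t-1},\quad \eta_0=f^*,\qquad \bar\eta_n=\frac1n\sum_{t=0}^{n-1}\eta_t,$$ and the bias part of its averaged excess risk is $\mathrm{Bias}=\mathbb E_{X,W}\langle\bar\eta_n,\Sigma_m\bar\eta_n\rangle$. *Assumptions.* 1. (High-dimensional setting with constants $0<c\le C$.) $cn\le d\le Cn$ and $cn\le m\le Cn$; $\|x\|_2^2$ is of order $d$, in the sense that $\|x\|_2^2\le Cd$ for $\rho_X$-almost every $x$ and $\mathbb E\|x\|_2^2\ge cd$; and $\|\Sigma_d\|_2\le C$. 2. (Bounded norm.) The map $W\mapsto f^*(W)$ is measurable and $\mathbb E_W\|f^*\|^4<\infty$. (This holds if $\|f^*\|\le B$ almost surely.) Write $\|f^*\|_{4}^2:=(\mathbb E_W\|f^*\|^4)^{1/2}$, so that $\|f^*\|_4\le B$ in that case. 3. $\sigma$ is Lipschitz continuous. 4. (Fourth moment condition.) There are $r',r\ge1$ such that for every positive semidefinite matrix $A$ $$\mathbb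 E_W[\Sigma_mA\Sigma_m]\preccurlyeq\mathbb E_W\mathbb E_x[\varphi(x)\varphi(x)^\top A\,\varphi(x)\varphi(x)^\top]\preccurlyeq r'\,\mathbb E_W[\mathrm{Tr}(\Sigma_mA)\Sigma_m]\preccurlyeq r\,\mathrm{Tr}(\widetilde\Sigma_mA)\widetilde\Sigma_m.$$ *Conclusion.* If $\sigma\not\equiv0$, then $\mathrm{Tr}(\widetilde\Sigma_m)$ is of order one: there are $0<a,b<\infty$ depending only on $\sigma,c,C$ with $a\le\mathrm{Tr}(\widetilde\Sigma_m)\le b$ whenever Assumption 1 holds. Moreover, there is $c_0>0$ depending only on $\sigma,c,C$ such that for every $g>0$ there is a constant $K>0$ depending only on $\sigma,c,C,g$ with the following property. For all $n,m,d,\rho,r',r$ as above, all $\zeta\in[0,1)$, and all $\gamma_0\ge g$ with $\gamma_0\,r'\,\mathrm{Tr}(\widetilde\Sigma_m)\le c_0$, i.e. $\gamma_0\lesssim\frac1{r'\mathrm{Tr}(\widetilde\Sigma_m)}$ of order one, the random variable $\langle\bar\eta_n,\Sigma_m\bar\eta_n\rangle$ is integrable and $$\mathrm{Bias}\le K\,\gamma_0\,r'\,n^{\zeta-1}\,\|f^*\|_4^2\qquad\text{and}\qquad\mathrm{Bias}\le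 K\,n^{\zeta-1}\,\|f^*\|_4^2 .$$ In particular $\mathrm{Bias}=O(n^{\zeta-1})$ when $\|f^*\|_4$ stays bounded, and this bound decreases monotonically in $n$. -/

import Mathlib

open MeasureTheory ProbabilityTheory
open scoped Matrix

noncomputable section

/-- The random feature map `φ(x) = m^{-1/2} σ(W x / √d) ∈ ℝ^m`, with `σ` applied entrywise. -/
def featureMap {m d : ℕ} (σ : ℝ → ℝ) (W : Fin m → Fin d → ℝ)
    (x : EuclideanSpace ℝ (Fin d)) : EuclideanSpace ℝ (Fin m) :=
  WithLp.toLp 2 fun i => (1 / √(m : ℝ)) * σ ((∑ j, W i j * x j) / √(d : ℝ))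

/-- The law of the random feature matrix `W`: i.i.d. standard Gaussian entries. -/
def gaussianWeights (m d : ℕ) : Measure (Fin m → Fin d → ℝ) :=
  Measure.pi fun _ => Measure.pi fun _ => gaussianReal 0 1

/-- The rank-one matrix `φ(x) ⊗ φ(x)`. -/
def featureOuter {m d : ℕ} (σ : ℝ → ℝ) (W : Fin m → Fin d → ℝ)
    (x : EuclideanSpace ℝ (Fin d)) : Matrix (Fin m) (Fin m) ℝ :=
  Matrix.of fun i j => featureMap σ W x i * featureMap σ W x j

/-- The feature covariance `Σ_m = E_x[φ(x) ⊗ φ(x)]`, a function of `W`. -/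
def featureCov {m d : ℕ} (σ : ℝ → ℝ) (ρ : Measure (EuclideanSpace ℝ (Fin d) × ℝ))
    (W : Fin m → Fin d → ℝ) : Matrix (Fin m) (Fin m) ℝ :=
  Matrix.of fun i j => ∫ x, featureOuter σ W x i j ∂ρ.fst

/-- The expected feature covariance `Σ̃_m = E_W[Σ_m]`. -/
def expectedFeatureCov {d : ℕ} (σ : ℝ → ℝ) (ρ : Measure (EuclideanSpace ℝ (Fin d) × ℝ))
    (m : ℕ) : Matrix (Fin m) (Fin m) ℝ :=
  Matrix.of fun i j => ∫ W, featureCov σ ρ W i j ∂(gaussianWeights m d)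

/-- The data covariance `Σ_d = E_x[x ⊗ x]`. -/
def dataCov {d : ℕ} (ρ : Measure (EuclideanSpace ℝ (Fin d) × ℝ)) :
    Matrix (Fin d) (Fin d) ℝ :=
  Matrix.of fun i j => ∫ x, x i * x j ∂ρ.fst

/-- The high-dimensional setting with constants `c`, `C`: the dimensions are proportional to the
sample size, `‖x‖²` is of order `d`, and the spectral norm of `Σ_d` is bounded. -/
structure HighDimensional (c C : ℝ) (n m d : ℕ)
    (ρ : Measure (EuclideanSpace ℝ (Fin d) × ℝ)) : Prop where
  dim_lower : c * n ≤ d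
  dim_upper : (d : ℝ) ≤ C * n
  features_lower : c * n ≤ m
  features_upper : (m : ℝ) ≤ C * n
  /-- The data are bounded: `‖x‖² ≤ C d` almost surely. -/
  norm_upper : ∀ᵐ x ∂ρ.fst, ‖x‖ ^ 2 ≤ C * d
  /-- `‖x‖²` is at least of order `d`; this is only required on average. -/
  norm_lower : c * d ≤ ∫ x, ‖x‖ ^ 2 ∂ρ.fst
  spectral_norm : ‖Matrix.toEuclideanCLM (𝕜 := ℝ) (dataCov ρ)‖ ≤ C

/-- The fourth moment condition with constants `r'` and `r`: for every PSD matrix `A`,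
`E_W[Σ_m A Σ_m] ≼ E_W E_x[(φ ⊗ φ) A (φ ⊗ φ)] ≼ r' E_W[Tr(Σ_m A) Σ_m] ≼ r Tr(Σ̃_m A) Σ̃_m`. -/
structure FourthMomentCondition {d : ℕ} (σ : ℝ → ℝ)
    (ρ : Measure (EuclideanSpace ℝ (Fin d) × ℝ)) (m : ℕ) (r' r : ℝ) : Prop where
  one_le_r' : 1 ≤ r'
  one_le_r : 1 ≤ r
  lower : ∀ A : Matrix (Fin m) (Fin m) ℝ, A.PosSemidef →
    ((Matrix.of fun i j => ∫ W, ∫ x, (featureOuter σ W x * A * featureOuter σ W x) i j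
        ∂ρ.fst ∂(gaussianWeights m d)) -
      (Matrix.of fun i j => ∫ W, (featureCov σ ρ W * A * featureCov σ ρ W) i j
        ∂(gaussianWeights m d))).PosSemidef
  middle : ∀ A : Matrix (Fin m) (Fin m) ℝ, A.PosSemidef →
    (r' • (Matrix.of fun i j => ∫ W, (featureCov σ ρ W * A).trace * featureCov σ ρ W i j
        ∂(gaussianWeights m d)) -
      (Matrix.of fun i j => ∫ W, ∫ x, (featureOuter σ W x * A * featureOuter σ W x) i j
        ∂ρ.fst ∂(gaussianWeights m d))).PosSemidef
  upper : ∀ A : Matrix (Fin m) (Fin m) ℝ, A.PosSemidef →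
    ((r * (expectedFeatureCov σ ρ m * A).trace) • expectedFeatureCov σ ρ m -
      r' • (Matrix.of fun i j => ∫ W, (featureCov σ ρ W * A).trace * featureCov σ ρ W i j
        ∂(gaussianWeights m d))).PosSemidef

/-- The expected squared loss of `f = ⟨θ, φ(·)⟩` for given random features `W`. -/
def expectedRisk {m d : ℕ} (σ : ℝ → ℝ) (ρ : Measure (EuclideanSpace ℝ (Fin d) × ℝ))
    (W : Fin m → Fin d → ℝ) (θ : EuclideanSpace ℝ (Fin m)) : ℝ :=
  ∫ z, (inner ℝ θ (featureMap σ W z.1) - z.2) ^ 2 ∂ρ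

/-- `θ` represents `f* = argmin_{f ∈ ℋ} ℰ(f)`: it minimizes the expected risk, and it has the least
norm among all minimizers (so `‖θ‖` is the Hilbert norm of `f*`). -/
structure IsOptimal {m d : ℕ} (σ : ℝ → ℝ) (ρ : Measure (EuclideanSpace ℝ (Fin d) × ℝ))
    (W : Fin m → Fin d → ℝ) (θ : EuclideanSpace ℝ (Fin m)) : Prop where
  minimal : ∀ θ', expectedRisk σ ρ W θ ≤ expectedRisk σ ρ W θ'
  least_norm : ∀ θ', (∀ θ'', expectedRisk σ ρ W θ' ≤ expectedRisk σ ρ W θ'') → ‖θ‖ ≤ ‖θ'‖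

/-- The polynomially decaying step size `γ_t = γ₀ t^{-ζ}`. -/
def stepSize (γ₀ ζ : ℝ) (t : ℕ) : ℝ := γ₀ * (t : ℝ) ^ (-ζ)

/-- The bias iterates `η_t = [I - γ_t φ(x_t) ⊗ φ(x_t)] η_{t-1}`, `η_0 = f*`, of one-pass SGD run on
the sample `z = (x_t, y_t)_{t=1..n}`; the point `(x_{t+1}, y_{t+1})` is stored at index `t`. -/
def biasIterate {n m d : ℕ} (σ : ℝ → ℝ) (γ₀ ζ : ℝ) (W : Fin m → Fin d → ℝ)
    (θ : EuclideanSpace ℝ (Fin m)) (z : Fin n → EuclideanSpace ℝ (Fin d) × ℝ) :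
    ℕ → EuclideanSpace ℝ (Fin m)
  | 0 => θ
  | t + 1 =>
    if h : t < n then
      biasIterate σ γ₀ ζ W θ z t -
        (stepSize γ₀ ζ (t + 1) *
          inner ℝ (featureMap σ W (z ⟨t, h⟩).1) (biasIterate σ γ₀ ζ W θ z t)) •
            featureMap σ W (z ⟨t, h⟩).1
    else biasIterate σ γ₀ ζ W θ z t

/-- The averaged bias iterate `η̄_n = n⁻¹ ∑_{t=0}^{n-1} η_t`. -/
def averagedBias {n m d : ℕ} (σ : ℝ → ℝ) (γ₀ ζ : ℝ) (W : Fin m → Fin d → ℝ)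
    (θ : EuclideanSpace ℝ (Fin m)) (z : Fin n → EuclideanSpace ℝ (Fin d) × ℝ) :
    EuclideanSpace ℝ (Fin m) :=
  (1 / (n : ℝ)) • ∑ t ∈ Finset.range n, biasIterate σ γ₀ ζ W θ z t

/-- The random variable `⟨η̄_n, Σ_m η̄_n⟩` as a function of the weights and the sample; `θstar W` is
the optimal parameter for the weights `W`. -/
def biasLoss {n m d : ℕ} (σ : ℝ → ℝ) (ρ : Measure (EuclideanSpace ℝ (Fin d) × ℝ)) (γ₀ ζ : ℝ)
    (θstar : (Fin m → Fin d → ℝ) → EuclideanSpace ℝ (Fin m))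
    (p : (Fin m → Fin d → ℝ) × (Fin n → EuclideanSpace ℝ (Fin d) × ℝ)) : ℝ :=
  inner ℝ (averagedBias σ γ₀ ζ p.1 (θstar p.1) p.2)
    (Matrix.toEuclideanCLM (𝕜 := ℝ) (featureCov σ ρ p.1)
      (averagedBias σ γ₀ ζ p.1 (θstar p.1) p.2))

/-- The joint law of the weights `W` and of `n` i.i.d. samples from `ρ`, independent of `W`. -/
def jointLaw (n m : ℕ) {d : ℕ} (ρ : Measure (EuclideanSpace ℝ (Fin d) × ℝ)) :
    Measure ((Fin m → Fin d → ℝ) × (Fin n → EuclideanSpace ℝ (Fin d) × ℝ)) :=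
  (gaussianWeights m d).prod (Measure.pi fun _ => ρ)

/-- `Bias = E_{X,W} ⟨η̄_n, Σ_m η̄_n⟩`. -/
def bias (n : ℕ) {m d : ℕ} (σ : ℝ → ℝ) (ρ : Measure (EuclideanSpace ℝ (Fin d) × ℝ)) (γ₀ ζ : ℝ)
    (θstar : (Fin m → Fin d → ℝ) → EuclideanSpace ℝ (Fin m)) : ℝ :=
  ∫ p, biasLoss (n := n) σ ρ γ₀ ζ θstar p ∂(jointLaw n m ρ)

end

/-! The argument conditions on `W` and treats the bias recursion as SGD on a noiseless problem.
Suppose `‖φ(x)‖² ≤ R` almost surely and `γ₀ R ≤ 1`. Each step then lowers `‖η‖²` by at least `γ_t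
⟨φ(x_t), η_{t-1}⟩²`, so telescoping bounds the sum of these squares by `n^ζ ‖f*‖² / γ₀`
(`sum_inner_sq_biasIterate_le`). The iterate `η_{t-1}` does not depend on `x_t`, so each square has
expectation `E⟨η_{t-1}, Σ_m η_{t-1}⟩`. Convexity passes to the average iterate and gives the
conditional rate `n^(ζ-1) ‖f*‖² / γ₀` (`integral_biasLoss_le_of_mul_le_one`).

The Gaussian weights are unbounded, and `R` grows like `1 + ‖W‖²/m`, so `γ₀ R ≤ 1` can fail. There
the iterates grow at most geometrically and the loss is at most `exp(3nγ₀R) ‖f*‖² / γ₀`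
(`biasLoss_le_exp`). The operator norm satisfies `E exp(‖W‖²/25) ≤ 5^d D^m`
(`exists_lintegral_exp_weightNorm_le`), which is `exp(O(n))` because `d` and `m` are proportional to
`n`. For `γ₀` below a constant, a Chernoff factor makes the contribution of such weights
exponentially small. Cauchy–Schwarz in `W` separates this factor from `‖f*‖²`, whence the fourth
moment of `‖f*‖` (`exists_stepSize_bound`).

The trace of the expected covariance is the mean of `E_z σ(‖x‖z/√d)²`. It is bounded above since `σ`
is Lipschitz, and below by compactness and positivity. The lower bound, with `r' ≥ 1`, turns the
hypothesis on `γ₀ r' Tr` into a bound on `γ₀` alone. -/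

/-! ### Gaussian weights and exponential moments of their operator norm. -/

instance (m d : ℕ) : IsProbabilityMeasure (gaussianWeights m d) := by
  unfold gaussianWeights; infer_instance

/-- Rotation invariance of the Gaussian, checked on characteristic functions: both sides give
`exp(-t²‖x‖²/2)`. -/
theorem map_sum_mul_pi_gaussianReal {d : ℕ} (x : EuclideanSpace ℝ (Fin d)) :
    (Measure.pi fun _ : Fin d => gaussianReal 0 1).map (fun w => ∑ j, w j * x j) =
      (gaussianReal 0 1).map (fun z => ‖x‖ * z) := by
  have h0 : (fun w : Fin d → ℝ => ∑ j, w j * x j) =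
      (fun y : EuclideanSpace ℝ (Fin d) => inner ℝ x y) ∘ (WithLp.toLp 2) := by
    ext w; simp [PiLp.inner_apply]
  rw [h0, ← Measure.map_map (by fun_prop) (by fun_prop), map_pi_eq_stdGaussian]
  apply Measure.ext_of_charFun
  ext t
  rw [charFun_apply_real, integral_map (by fun_prop) (by fun_prop)]
  have h1 := charFun_stdGaussian (E := EuclideanSpace ℝ (Fin d)) (t • x)
  rw [charFun_apply] at h1
  have h2 := charFun_gaussianReal (μ := 0) (v := 1) (t * ‖x‖)
  rw [charFun_apply_real] at h2
  rw [charFun_apply_real, integral_map (by fun_prop) (by fun_prop)]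
  have e1 : ∀ y : EuclideanSpace ℝ (Fin d), (inner ℝ y (t • x) : ℝ) = t * inner ℝ x y := by
    intro y; rw [inner_smul_right, real_inner_comm]
  simp only [e1] at h1
  push_cast at h1 h2 ⊢
  rw [h1]
  simp only [← mul_assoc]
  rw [h2, norm_smul]
  congr 1
  push_cast
  rw [mul_pow, mul_pow, ← Complex.ofReal_pow, Real.norm_eq_abs, sq_abs]
  push_cast
  ring

theorem lintegral_weights_row {m d : ℕ} (x : EuclideanSpace ℝ (Fin d)) (i : Fin m)
    {f : ℝ → ENNReal} (hf : Measurable f) :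
    ∫⁻ W, f (∑ j, W i j * x j) ∂(gaussianWeights m d) =
      ∫⁻ z, f (‖x‖ * z) ∂(gaussianReal 0 1) := by
  have h := (measurePreserving_eval
    (fun _ : Fin m => Measure.pi fun _ : Fin d => gaussianReal 0 1) i).lintegral_comp
      (f := fun w => f (∑ j, w j * x j)) (by fun_prop)
  have h2 := lintegral_map (μ := Measure.pi fun _ : Fin d => gaussianReal 0 1) hf
    (g := fun w => ∑ j, w j * x j) (by fun_prop)
  rw [map_sum_mul_pi_gaussianReal, lintegral_map hf (by fun_prop)] at h2
  rw [h2]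
  exact h

theorem integral_weights_row {m d : ℕ} (x : EuclideanSpace ℝ (Fin d)) (i : Fin m)
    {f : ℝ → ℝ} (hf : Continuous f) :
    ∫ W, f (∑ j, W i j * x j) ∂(gaussianWeights m d) =
      ∫ z, f (‖x‖ * z) ∂(gaussianReal 0 1) := by
  have h := integral_map (μ := gaussianWeights m d) (measurePreserving_eval
    (fun _ : Fin m => Measure.pi fun _ : Fin d => gaussianReal 0 1) i).measurable.aemeasurable
      (f := fun w => f (∑ j, w j * x j)) (Continuous.aestronglyMeasurable (by fun_prop))
  have hmap : (gaussianWeights m d).map (Function.eval i) =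
      Measure.pi fun _ : Fin d => gaussianReal 0 1 :=
    (measurePreserving_eval
      (fun _ : Fin m => Measure.pi fun _ : Fin d => gaussianReal 0 1) i).map_eq
  rw [hmap] at h
  have h2 := integral_map (μ := Measure.pi fun _ : Fin d => gaussianReal 0 1)
    (φ := fun w => ∑ j, w j * x j) (Measurable.aemeasurable (by fun_prop)) hf.aestronglyMeasurable
  rw [map_sum_mul_pi_gaussianReal, integral_map (by fun_prop) hf.aestronglyMeasurable] at h2
  rw [h2]
  exact h.symm

/-- The operator norm of the weights as a map between Euclidean spaces. -/
noncomputable def weightNorm {m d : ℕ} (W : Fin m → Fin d → ℝ) : ℝ :=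
  ‖LinearMap.toContinuousLinearMap (Matrix.toEuclideanLin (Matrix.of W))‖

theorem weightNorm_nonneg {m d : ℕ} (W : Fin m → Fin d → ℝ) : 0 ≤ weightNorm W := norm_nonneg _

theorem continuous_weightNorm {m d : ℕ} : Continuous (weightNorm (m := m) (d := d)) := by
  let F : (Fin m → Fin d → ℝ) →ₗ[ℝ] (EuclideanSpace ℝ (Fin d) →L[ℝ] EuclideanSpace ℝ (Fin m)) :=
    { toFun := fun W => LinearMap.toContinuousLinearMap (Matrix.toEuclideanLin (Matrix.of W))
      map_add' := fun a b => by rw [← map_add, ← map_add]; rfl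
      map_smul' := fun a b => by rw [RingHom.id_apply, ← map_smul, ← map_smul]; rfl }
  exact (F.continuous_of_finiteDimensional).norm

theorem norm_toEuclideanLin_sq {m d : ℕ} (W : Fin m → Fin d → ℝ)
    (x : EuclideanSpace ℝ (Fin d)) :
    ‖Matrix.toEuclideanLin (Matrix.of W) x‖ ^ 2 = ∑ i, (∑ j, W i j * x j) ^ 2 := by
  rw [EuclideanSpace.norm_sq_eq]
  simp [Matrix.mulVec, dotProduct]

theorem sum_sq_weights_mul_le {m d : ℕ} (W : Fin m → Fin d → ℝ)
    (x : EuclideanSpace ℝ (Fin d)) :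
    ∑ i, (∑ j, W i j * x j) ^ 2 ≤ weightNorm W ^ 2 * ‖x‖ ^ 2 := by
  rw [← norm_toEuclideanLin_sq, ← mul_pow]
  gcongr
  exact (LinearMap.toContinuousLinearMap (Matrix.toEuclideanLin (Matrix.of W))).le_opNorm x

/-- The exponential of `‖Wx‖²` factors over the independent rows of `W`, each contributing the same
one-dimensional integral. -/
theorem lintegral_exp_sq_weights {m d : ℕ} (t : ℝ) (x : EuclideanSpace ℝ (Fin d)) :
    ∫⁻ W, ENNReal.ofReal (Real.exp (t * ∑ i, (∑ j, W i j * x j) ^ 2)) ∂(gaussianWeights m d) =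
      (∫⁻ z, ENNReal.ofReal (Real.exp (t * (‖x‖ * z) ^ 2)) ∂(gaussianReal 0 1)) ^ m := by
  have h : ∀ W : Fin m → Fin d → ℝ,
      ENNReal.ofReal (Real.exp (t * ∑ i, (∑ j, W i j * x j) ^ 2)) =
        ∏ i, ENNReal.ofReal (Real.exp (t * (∑ j, W i j * x j) ^ 2)) := by
    intro W
    rw [Finset.mul_sum, Real.exp_sum, ENNReal.ofReal_prod_of_nonneg]
    intros; positivity
  simp_rw [h]
  have hi : iIndepFun (fun (i : Fin m) (W : Fin m → Fin d → ℝ) => W i) (gaussianWeights m d) := by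
    have := iIndepFun_pi (μ := fun _ : Fin m => Measure.pi fun _ : Fin d => gaussianReal 0 1)
      (X := fun _ => id) (fun _ => measurable_id.aemeasurable)
    exact this
  have hi2 := hi.comp (fun _ w => ENNReal.ofReal (Real.exp (t * (∑ j, w j * x j) ^ 2)))
    (fun _ => by fun_prop)
  have := lintegral_prod_eq_prod_lintegral_of_indepFun Finset.univ _ hi2 (fun i => by
    simp only [Function.comp_def]; fun_prop)
  simp only [Function.comp_def] at this
  rw [this]
  have h3 : ∀ i : Fin m, ∫⁻ W, ENNReal.ofReal (Real.exp (t * (∑ j, W i j * x j) ^ 2))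
      ∂(gaussianWeights m d) =
      ∫⁻ z, ENNReal.ofReal (Real.exp (t * (‖x‖ * z) ^ 2)) ∂(gaussianReal 0 1) := fun i =>
    lintegral_weights_row x i (f := fun s => ENNReal.ofReal (Real.exp (t * s ^ 2)))
      (by fun_prop)
  simp [h3]

theorem integrable_exp_sq_gaussianReal :
    Integrable (fun z : ℝ => Real.exp (z ^ 2 / 4)) (gaussianReal 0 1) := by
  rw [gaussianReal_of_var_ne_zero 0 one_ne_zero,
    integrable_withDensity_iff_integrable_smul' (by fun_prop) (by simp [gaussianPDF])]
  have := (integrable_exp_neg_mul_sq (b := 1 / 4) (by norm_num)).const_mul (√(2 * Real.pi))⁻¹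
  refine this.congr (Filter.Eventually.of_forall fun z => ?_)
  simp only [toReal_gaussianPDF, gaussianPDFReal, smul_eq_mul, NNReal.coe_one, mul_one, sub_zero]
  rw [mul_assoc, ← Real.exp_add]
  congr 2; ring

/-- A volume argument in place of an ε-net. Around a near-maximizer of `‖Wx‖` there is a ball of
radius 1/4 on which `‖Wu‖ ≥ ‖W‖/2`, so the exponential of `‖W‖²` is at most an average over `u`.
Fubini then leaves, for fixed `u`, a product over rows. -/
theorem exists_lintegral_exp_weightNorm_le :
    ∃ D : ℝ, 1 ≤ D ∧ ∀ m d : ℕ,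
      ∫⁻ W, ENNReal.ofReal (Real.exp (weightNorm W ^ 2 / 25)) ∂(gaussianWeights m d) ≤
        ENNReal.ofReal (5 ^ d * D ^ m) := by
  refine ⟨max 1 (∫ z, Real.exp (z ^ 2 / 4) ∂(gaussianReal 0 1)), le_max_left _ _, ?_⟩
  intro m d
  set D := max 1 (∫ z, Real.exp (z ^ 2 / 4) ∂(gaussianReal 0 1)) with hD
  have hD0 : 0 ≤ D := le_trans zero_le_one (le_max_left _ _)
  let F : (Fin m → Fin d → ℝ) → EuclideanSpace ℝ (Fin d) → ENNReal := fun W u =>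
    ENNReal.ofReal (Real.exp (4 / 25 * ∑ i, (∑ j, W i j * u j) ^ 2))
  have hF : Measurable (Function.uncurry F) := by
    simp only [F, Function.uncurry_def]; fun_prop
  have hpt : ∀ W, ENNReal.ofReal (Real.exp (weightNorm W ^ 2 / 25)) *
      volume (Metric.ball (0 : EuclideanSpace ℝ (Fin d)) (1 / 4)) ≤ ∫⁻ u in Metric.ball (0 : EuclideanSpace ℝ (Fin d)) (5 / 4), F W u := by
    intro W
    obtain ⟨x, hx1, hx2⟩ : ∃ x : EuclideanSpace ℝ (Fin d), ‖x‖ < 1 ∧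
        3 / 4 * weightNorm W ≤ ‖Matrix.toEuclideanLin (Matrix.of W) x‖ := by
      rcases (weightNorm_nonneg W).eq_or_lt with h | h
      · exact ⟨0, by simp, by rw [← h]; simp⟩
      · obtain ⟨x, h1, h2⟩ := ContinuousLinearMap.exists_lt_apply_of_lt_opNorm
          (LinearMap.toContinuousLinearMap (Matrix.toEuclideanLin (Matrix.of W)))
          (r := 3 / 4 * weightNorm W) (by change _ < weightNorm W; linarith)
        exact ⟨x, h1, h2.le⟩
    calc _ = ∫⁻ _ in Metric.ball x (1 / 4), ENNReal.ofReal (Real.exp (weightNorm W ^ 2 / 25)) := by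
          rw [setLIntegral_const, Measure.addHaar_ball_center volume x]
      _ ≤ ∫⁻ u in Metric.ball x (1 / 4), F W u := by
          refine setLIntegral_mono' Metric.isOpen_ball.measurableSet fun u hu => ?_
          refine ENNReal.ofReal_le_ofReal (Real.exp_le_exp.2 ?_)
          rw [← norm_toEuclideanLin_sq]
          have h1 : ‖Matrix.toEuclideanLin (Matrix.of W) (x - u)‖ ≤ weightNorm W * ‖x - u‖ :=
            (LinearMap.toContinuousLinearMap (Matrix.toEuclideanLin (Matrix.of W))).le_opNorm _
          have h2 : ‖x - u‖ ≤ 1 / 4 := by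
            rw [← dist_eq_norm, dist_comm]; exact (Metric.mem_ball.1 hu).le
          have h3 : weightNorm W * ‖x - u‖ ≤ weightNorm W * (1 / 4) :=
            mul_le_mul_of_nonneg_left h2 (weightNorm_nonneg W)
          have h4 : ‖Matrix.toEuclideanLin (Matrix.of W) x‖ -
              ‖Matrix.toEuclideanLin (Matrix.of W) u‖ ≤
              ‖Matrix.toEuclideanLin (Matrix.of W) (x - u)‖ := by
            rw [map_sub]; exact norm_sub_norm_le _ _
          -- Here `3/4 - 1/4 = 1/2`; squaring turns the coefficient 4/25 into 1/25.
          have h5 : weightNorm W / 2 ≤ ‖Matrix.toEuclideanLin (Matrix.of W) u‖ := by linarith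
          have h6 := pow_le_pow_left₀ (by have := weightNorm_nonneg W; positivity) h5 2
          nlinarith
      _ ≤ _ := by
          refine lintegral_mono_set (Metric.ball_subset_ball' ?_)
          rw [dist_zero_right]; linarith
  -- The ratio of radii is 5, which is the source of the factor `5 ^ d`.
  have hball : volume (Metric.ball (0 : EuclideanSpace ℝ (Fin d)) (5 / 4)) =
      ENNReal.ofReal (5 ^ d) * volume (Metric.ball (0 : EuclideanSpace ℝ (Fin d)) (1 / 4)) := by
    have := Measure.addHaar_ball_mul_of_pos (volume : Measure (EuclideanSpace ℝ (Fin d))) 0 (r := 5) (by norm_num) (1 / 4)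
    rw [finrank_euclideanSpace_fin] at this
    rw [← this]; norm_num
  have hV0 : volume (Metric.ball (0 : EuclideanSpace ℝ (Fin d)) (1 / 4)) ≠ 0 :=
    (Metric.measure_ball_pos _ _ (by norm_num)).ne'
  have hV1 : volume (Metric.ball (0 : EuclideanSpace ℝ (Fin d)) (1 / 4)) ≠ ⊤ := measure_ball_lt_top.ne
  have hm : Measurable fun W : Fin m → Fin d → ℝ =>
      ENNReal.ofReal (Real.exp (weightNorm W ^ 2 / 25)) := by
    have := (continuous_weightNorm (m := m) (d := d)).measurable
    fun_prop
  rw [← ENNReal.mul_le_mul_iff_left hV0 hV1, ← lintegral_mul_const _ hm]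
  calc _ ≤ ∫⁻ W, (∫⁻ u in Metric.ball (0 : EuclideanSpace ℝ (Fin d)) (5 / 4), F W u)
          ∂(gaussianWeights m d) :=
        lintegral_mono hpt
    _ = ∫⁻ u in Metric.ball (0 : EuclideanSpace ℝ (Fin d)) (5 / 4),
          ∫⁻ W, F W u ∂(gaussianWeights m d) :=
        lintegral_lintegral_swap hF.aemeasurable
    _ ≤ ∫⁻ u in Metric.ball (0 : EuclideanSpace ℝ (Fin d)) (5 / 4), ENNReal.ofReal (D ^ m) := by
        refine setLIntegral_mono' Metric.isOpen_ball.measurableSet fun u hu => ?_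
        simp only [F]
        rw [lintegral_exp_sq_weights, ENNReal.ofReal_pow hD0]
        gcongr
        have hu' : ‖u‖ ≤ 5 / 4 := by simpa using (Metric.mem_ball.1 hu).le
        calc _ ≤ ∫⁻ z, ENNReal.ofReal (Real.exp (z ^ 2 / 4)) ∂(gaussianReal 0 1) := by
              refine lintegral_mono fun z => ENNReal.ofReal_le_ofReal (Real.exp_le_exp.2 ?_)
              -- On this ball `(4/25)‖u‖² ≤ (4/25)(25/16) = 1/4`, below the threshold 1/2 for
              -- Gaussian integrability.
              have := pow_le_pow_left₀ (norm_nonneg u) hu' 2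
              nlinarith [sq_nonneg z]
          _ = ENNReal.ofReal (∫ z, Real.exp (z ^ 2 / 4) ∂(gaussianReal 0 1)) :=
              (ofReal_integral_eq_lintegral_ofReal integrable_exp_sq_gaussianReal
                (Filter.Eventually.of_forall fun z => by positivity)).symm
          _ ≤ _ := ENNReal.ofReal_le_ofReal (le_max_right _ _)
    _ = _ := by
        rw [setLIntegral_const, hball, ENNReal.ofReal_mul (p := 5 ^ d) (by positivity)]
        ring

/-! ### Resampling one coordinate of an i.i.d. sample. -/

theorem measurePreserving_update_prod {n : ℕ} {α : Type*} [MeasurableSpace α] (ρ : Measure α)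
    [IsProbabilityMeasure ρ] (t : Fin n) :
    MeasurePreserving (fun p : (Fin n → α) × α => Function.update p.1 t p.2)
      ((Measure.pi fun _ => ρ).prod ρ) (Measure.pi fun _ => ρ) := by
  have hm : Measurable fun p : (Fin n → α) × α => Function.update p.1 t p.2 := by
    rw [measurable_pi_iff]
    intro i
    by_cases h : i = t
    · subst h; simpa using measurable_snd
    · simp only [Function.update_of_ne h]; fun_prop
  refine ⟨hm, (Measure.pi_eq fun s hs => ?_).symm⟩
  rw [Measure.map_apply hm (MeasurableSet.univ_pi hs)]
  have : (fun p : (Fin n → α) × α => Function.update p.1 t p.2) ⁻¹' (Set.univ.pi s) =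
      (Set.univ.pi (Function.update s t Set.univ)) ×ˢ s t := by
    ext p
    simp only [Set.mem_preimage, Set.mem_pi, Set.mem_univ, true_implies, Set.mem_prod]
    constructor
    · intro h
      refine ⟨fun i => ?_, by simpa using h t⟩
      by_cases hi : i = t
      · subst hi; simp
      · simpa [hi] using h i
    · rintro ⟨h1, h2⟩ i
      by_cases hi : i = t
      · subst hi; simpa using h2
      · simpa [hi] using h1 i
  rw [this, Measure.prod_prod, Measure.pi_pi, ← Finset.mul_prod_erase _ _ (Finset.mem_univ t),
    ← Finset.mul_prod_erase (a := t) _ (fun i => ρ (s i)) (Finset.mem_univ t)]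
  simp only [Function.update_self, measure_univ, one_mul]
  rw [mul_comm]
  congr 1
  refine Finset.prod_congr rfl fun i hi => ?_
  rw [Function.update_of_ne (Finset.ne_of_mem_erase hi)]

/-- A form of independence: `hft` says that `f z` ignores coordinate `t` of `z`, so the entry `z t`
may be replaced by a fresh draw. -/
theorem lintegral_pi_eval_eq {n : ℕ} {α : Type*} [MeasurableSpace α] (ρ : Measure α)
    [IsProbabilityMeasure ρ] (t : Fin n) {f : (Fin n → α) → α → ENNReal}
    (hf : Measurable (Function.uncurry f))
    (hft : ∀ z y y', f (Function.update z t y') y = f z y) :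
    ∫⁻ z, f z (z t) ∂(Measure.pi fun _ : Fin n => ρ) =
      ∫⁻ z, ∫⁻ y, f z y ∂ρ ∂(Measure.pi fun _ : Fin n => ρ) := by
  have h1 : Measurable fun z : Fin n → α => f z (z t) :=
    hf.comp (measurable_id.prodMk (measurable_pi_apply t))
  have hmp := measurePreserving_update_prod ρ t
  rw [← hmp.lintegral_comp h1]
  refine (lintegral_prod _ (h1.comp hmp.measurable).aemeasurable).trans ?_
  simp [hft]

theorem lintegral_pi_sum_eval_eq {n : ℕ} {α : Type*} [MeasurableSpace α] (ρ : Measure α)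
    [IsProbabilityMeasure ρ] {f : Fin n → (Fin n → α) → α → ENNReal}
    (hf : ∀ t, Measurable (Function.uncurry (f t)))
    (hft : ∀ t z y y', f t (Function.update z t y') y = f t z y) :
    ∫⁻ z, ∫⁻ y, ∑ t, f t z y ∂ρ ∂(Measure.pi fun _ : Fin n => ρ) =
      ∫⁻ z, ∑ t, f t z (z t) ∂(Measure.pi fun _ : Fin n => ρ) := by
  have hI : ∀ t, Measurable fun z => ∫⁻ y, f t z y ∂ρ := fun t => (hf t).lintegral_prod_right
  calc _ = ∫⁻ z, ∑ t, ∫⁻ y, f t z y ∂ρ ∂(Measure.pi fun _ : Fin n => ρ) :=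
        lintegral_congr fun z => lintegral_finsetSum _ fun t _ => (hf t).of_uncurry_left
    _ = ∑ t, ∫⁻ z, ∫⁻ y, f t z y ∂ρ ∂(Measure.pi fun _ : Fin n => ρ) :=
        lintegral_finsetSum _ fun t _ => hI t
    _ = ∑ t, ∫⁻ z, f t z (z t) ∂(Measure.pi fun _ : Fin n => ρ) :=
        Finset.sum_congr rfl fun t _ => (lintegral_pi_eval_eq ρ t (hf t) (hft t)).symm
    _ = _ := (lintegral_finsetSum _ fun t _ =>
        (hf t).comp (measurable_id.prodMk (measurable_pi_apply t))).symm

/-! ### Regularity of the bias iterates and bounds on the step size. -/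

theorem continuous_featureMap {m d : ℕ} {σ : ℝ → ℝ} (hσ : Continuous σ) :
    Continuous fun p : (Fin m → Fin d → ℝ) × EuclideanSpace ℝ (Fin d) =>
      featureMap σ p.1 p.2 := by
  unfold featureMap
  fun_prop

theorem continuous_biasIterate {n m d : ℕ} {σ : ℝ → ℝ} (hσ : Continuous σ) (γ₀ ζ : ℝ) (t : ℕ) :
    Continuous fun q : (Fin m → Fin d → ℝ) × EuclideanSpace ℝ (Fin m) ×
      (Fin n → EuclideanSpace ℝ (Fin d) × ℝ) => biasIterate σ γ₀ ζ q.1 q.2.1 q.2.2 t := by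
  induction t with
  | zero => simp only [biasIterate]; fun_prop
  | succ t ih =>
    simp only [biasIterate]
    split_ifs with h
    · have hφ : Continuous fun q : (Fin m → Fin d → ℝ) × EuclideanSpace ℝ (Fin m) ×
          (Fin n → EuclideanSpace ℝ (Fin d) × ℝ) => featureMap σ q.1 (q.2.2 ⟨t, h⟩).1 :=
        (continuous_featureMap hσ).comp (f := fun q : (Fin m → Fin d → ℝ) ×
          EuclideanSpace ℝ (Fin m) × (Fin n → EuclideanSpace ℝ (Fin d) × ℝ) =>
            (q.1, (q.2.2 ⟨t, h⟩).1)) (by fun_prop)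
      fun_prop
    · exact ih

/-- Adaptedness: iterate `t` has seen only indices below `t`, so `z t` is a fresh point for it. -/
theorem biasIterate_congr {n m d : ℕ} (σ : ℝ → ℝ) (γ₀ ζ : ℝ) (W : Fin m → Fin d → ℝ)
    (θ : EuclideanSpace ℝ (Fin m)) {z z' : Fin n → EuclideanSpace ℝ (Fin d) × ℝ} {t : ℕ}
    (h : ∀ i : Fin n, (i : ℕ) < t → z i = z' i) :
    biasIterate σ γ₀ ζ W θ z t = biasIterate σ γ₀ ζ W θ z' t := by
  induction t with
  | zero => rfl
  | succ t ih =>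
    have := ih fun i hi => h i (by omega)
    simp only [biasIterate, this]
    split_ifs with ht
    · rw [h ⟨t, ht⟩ (by simp)]
    · rfl

theorem stepSize_nonneg {γ₀ : ℝ} (hγ : 0 ≤ γ₀) (ζ : ℝ) (t : ℕ) : 0 ≤ stepSize γ₀ ζ t := by
  unfold stepSize; positivity

theorem stepSize_succ_le {γ₀ ζ : ℝ} (hγ : 0 ≤ γ₀) (hζ : 0 ≤ ζ) (t : ℕ) :
    stepSize γ₀ ζ (t + 1) ≤ γ₀ := by
  unfold stepSize
  refine mul_le_of_le_one_right hγ (Real.rpow_le_one_of_one_le_of_nonpos ?_ (by linarith))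
  push_cast; linarith [(Nat.cast_nonneg t : (0 : ℝ) ≤ t)]

theorem le_stepSize_succ {γ₀ ζ : ℝ} (hγ : 0 ≤ γ₀) (hζ : 0 ≤ ζ) {t n : ℕ} (h : t < n) :
    γ₀ * (n : ℝ) ^ (-ζ) ≤ stepSize γ₀ ζ (t + 1) := by
  unfold stepSize
  refine mul_le_mul_of_nonneg_left (Real.rpow_le_rpow_of_nonpos ?_ ?_ (by linarith)) hγ
  · positivity
  · exact_mod_cast h

/-! ### Pathwise estimates for a fixed sample and fixed weights. -/

section Pathwise

variable {n m d : ℕ} {σ : ℝ → ℝ} {γ₀ ζ : ℝ} {W : Fin m → Fin d → ℝ}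
  {θ : EuclideanSpace ℝ (Fin m)} {z : Fin n → EuclideanSpace ℝ (Fin d) × ℝ} {R : ℝ}

theorem norm_biasIterate_le (hγ : 0 ≤ γ₀) (hζ : 0 ≤ ζ) (hR : 0 ≤ R)
    (hz : ∀ i, ‖featureMap σ W (z i).1‖ ^ 2 ≤ R) (t : ℕ) :
    ‖biasIterate σ γ₀ ζ W θ z t‖ ≤ (1 + γ₀ * R) ^ t * ‖θ‖ := by
  induction t with
  | zero => simp [biasIterate]
  | succ t ih =>
    have hx : 0 ≤ γ₀ * R := mul_nonneg hγ hR
    have hnn := norm_nonneg (biasIterate σ γ₀ ζ W θ z t)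
    simp only [biasIterate]
    split_ifs with h
    · set η := biasIterate σ γ₀ ζ W θ z t
      set φ := featureMap σ W (z ⟨t, h⟩).1
      have hs := stepSize_nonneg hγ ζ (t + 1)
      calc _ ≤ ‖η‖ + ‖(stepSize γ₀ ζ (t + 1) * inner ℝ φ η) • φ‖ := norm_sub_le _ _
        _ ≤ ‖η‖ + γ₀ * R * ‖η‖ := by
          rw [norm_smul, norm_mul, Real.norm_of_nonneg hs]
          have h1 : ‖(inner ℝ φ η : ℝ)‖ ≤ ‖φ‖ * ‖η‖ := norm_inner_le_norm _ _
          calc _ ≤ ‖η‖ + stepSize γ₀ ζ (t + 1) * (‖φ‖ * ‖η‖) * ‖φ‖ := by gcongr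
            _ = ‖η‖ + stepSize γ₀ ζ (t + 1) * ‖φ‖ ^ 2 * ‖η‖ := by ring
            _ ≤ _ := by
              gcongr
              · exact stepSize_succ_le hγ hζ t
              · exact hz _
        _ = (1 + γ₀ * R) * ‖η‖ := by ring
        _ ≤ (1 + γ₀ * R) * ((1 + γ₀ * R) ^ t * ‖θ‖) := by gcongr
        _ = _ := by ring
    · refine ih.trans ?_
      gcongr
      · linarith
      · omega

/-- Energy estimate: `‖η‖²` pays for the squared residuals at every step, and each step size up to
time `n` is at least `γ₀ n^(-ζ)`. -/
theorem sum_inner_sq_biasIterate_le (hγ : 0 ≤ γ₀) (hζ : 0 ≤ ζ)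
    (hz : ∀ i, ‖featureMap σ W (z i).1‖ ^ 2 ≤ R) (hR : γ₀ * R ≤ 1) :
    γ₀ * (n : ℝ) ^ (-ζ) *
      ∑ t : Fin n, inner ℝ (featureMap σ W (z t).1) (biasIterate σ γ₀ ζ W θ z t) ^ 2 ≤
        ‖θ‖ ^ 2 := by
  have key : ∀ k, k ≤ n → ‖biasIterate σ γ₀ ζ W θ z k‖ ^ 2 + γ₀ * (n : ℝ) ^ (-ζ) *
      ∑ t : Fin n, (if (t : ℕ) < k then
        inner ℝ (featureMap σ W (z t).1) (biasIterate σ γ₀ ζ W θ z t) ^ 2 else 0) ≤ ‖θ‖ ^ 2 := by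
    intro k
    induction k with
    | zero => simp [biasIterate]
    | succ k ih =>
      intro hk
      have hk' : k < n := hk
      have hsum : ∑ t : Fin n, (if (t : ℕ) < k + 1 then
          (inner ℝ (featureMap σ W (z t).1) (biasIterate σ γ₀ ζ W θ z t) : ℝ) ^ 2 else 0) =
          ∑ t : Fin n, (if (t : ℕ) < k then
          (inner ℝ (featureMap σ W (z t).1) (biasIterate σ γ₀ ζ W θ z t) : ℝ) ^ 2 else 0) +
          (inner ℝ (featureMap σ W (z ⟨k, hk'⟩).1) (biasIterate σ γ₀ ζ W θ z k) : ℝ) ^ 2 := by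
        rw [← Finset.add_sum_erase _ _ (Finset.mem_univ (⟨k, hk'⟩ : Fin n)),
          ← Finset.add_sum_erase (a := (⟨k, hk'⟩ : Fin n)) _
            (fun t : Fin n => if (t : ℕ) < k then
              (inner ℝ (featureMap σ W (z t).1) (biasIterate σ γ₀ ζ W θ z t) : ℝ) ^ 2 else 0)
            (Finset.mem_univ _)]
        simp only [lt_add_iff_pos_right, Nat.lt_one_iff, pos_of_gt, if_true, lt_irrefl, if_false,
          zero_add]
        rw [add_comm]
        congr 1
        refine Finset.sum_congr rfl fun t ht => ?_
        have : (t : ℕ) ≠ k := fun h => Finset.ne_of_mem_erase ht (Fin.ext h)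
        have : (t : ℕ) < k + 1 ↔ (t : ℕ) < k := by omega
        simp only [this]
      rw [hsum]
      have hstep : biasIterate σ γ₀ ζ W θ z (k + 1) = biasIterate σ γ₀ ζ W θ z k -
          (stepSize γ₀ ζ (k + 1) * inner ℝ (featureMap σ W (z ⟨k, hk'⟩).1)
            (biasIterate σ γ₀ ζ W θ z k)) • featureMap σ W (z ⟨k, hk'⟩).1 := by
        simp [biasIterate, hk']
      rw [hstep]
      set η := biasIterate σ γ₀ ζ W θ z k
      set φ := featureMap σ W (z ⟨k, hk'⟩).1
      set s := stepSize γ₀ ζ (k + 1)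
      set p : ℝ := inner ℝ φ η
      have h1 : ‖η - (s * p) • φ‖ ^ 2 = ‖η‖ ^ 2 - 2 * (s * p) * p + (s * p) ^ 2 * ‖φ‖ ^ 2 := by
        rw [norm_sub_sq_real, inner_smul_right, norm_smul, mul_pow, Real.norm_eq_abs, sq_abs,
          real_inner_comm]
        ring
      have hs0 : 0 ≤ s := stepSize_nonneg hγ ζ (k + 1)
      have hs1 : s * ‖φ‖ ^ 2 ≤ 1 := by
        refine le_trans ?_ hR
        gcongr
        · exact stepSize_succ_le hγ hζ k
        · exact hz _
      have hs2 : γ₀ * (n : ℝ) ^ (-ζ) ≤ s := le_stepSize_succ hγ hζ hk'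
      -- The quadratic term uses up at most half of the decrease `2 s p²`, leaving `s p²`.
      have h2 : (s * p) ^ 2 * ‖φ‖ ^ 2 ≤ s * p ^ 2 := by
        have : (s * p) ^ 2 * ‖φ‖ ^ 2 = (s * p ^ 2) * (s * ‖φ‖ ^ 2) := by ring
        rw [this]
        exact mul_le_of_le_one_right (by positivity) hs1
      have h3 : γ₀ * (n : ℝ) ^ (-ζ) * p ^ 2 ≤ s * p ^ 2 := by gcongr
      have := ih hk'.le
      rw [h1, mul_add]
      linarith
  have := key n le_rfl
  simp only [Fin.is_lt, if_true] at this
  nlinarith [sq_nonneg ‖biasIterate σ γ₀ ζ W θ z n‖]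

end Pathwise

/-! ### The quadratic form of the feature covariance. -/

section Covariance

variable {m d : ℕ} {σ : ℝ → ℝ} {ρ : Measure (EuclideanSpace ℝ (Fin d) × ℝ)}
  [IsProbabilityMeasure ρ] {W : Fin m → Fin d → ℝ} {R : ℝ}

theorem integrable_featureMap_mul (hσ : Continuous σ)
    (hR : ∀ᵐ x ∂ρ.fst, ‖featureMap σ W x‖ ^ 2 ≤ R) (i j : Fin m) :
    Integrable (fun x => featureMap σ W x i * featureMap σ W x j) ρ.fst := by
  have hc : Continuous fun x => featureMap σ W x :=
    (continuous_featureMap hσ).comp (f := fun x => (W, x)) (by fun_prop)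
  refine Integrable.of_bound (C := R) (Continuous.aestronglyMeasurable (by fun_prop)) ?_
  filter_upwards [hR] with x hx
  rw [norm_mul]
  have hi := PiLp.norm_apply_le (featureMap σ W x) i
  have hj := PiLp.norm_apply_le (featureMap σ W x) j
  nlinarith [norm_nonneg (featureMap σ W x i), norm_nonneg (featureMap σ W x j)]

theorem inner_featureCov (hσ : Continuous σ)
    (hR : ∀ᵐ x ∂ρ.fst, ‖featureMap σ W x‖ ^ 2 ≤ R) (v : EuclideanSpace ℝ (Fin m)) :
    inner ℝ v (Matrix.toEuclideanCLM (𝕜 := ℝ) (featureCov σ ρ W) v) =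
      ∫ x, inner ℝ (featureMap σ W x) v ^ 2 ∂ρ.fst := by
  have hint := integrable_featureMap_mul (ρ := ρ) hσ hR
  have h1 : ∀ x, (inner ℝ (featureMap σ W x) v : ℝ) ^ 2 =
      ∑ i, ∑ j, v i * (v j * (featureMap σ W x i * featureMap σ W x j)) := by
    intro x
    simp only [PiLp.inner_apply, RCLike.inner_apply, conj_trivial]
    rw [sq, Finset.sum_mul_sum]
    exact Finset.sum_congr rfl fun i _ => Finset.sum_congr rfl fun j _ => by ring
  simp_rw [h1]
  rw [integral_finsetSum _ fun i _ => integrable_finsetSum _ fun j _ =>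
    ((hint i j).const_mul _).const_mul _]
  simp_rw [integral_finsetSum _ fun j _ => ((hint _ j).const_mul _).const_mul _,
    integral_const_mul]
  rw [PiLp.inner_apply]
  refine Finset.sum_congr rfl fun i _ => ?_
  simp only [RCLike.inner_apply, conj_trivial, Matrix.ofLp_toEuclideanCLM, Matrix.mulVec,
    dotProduct, Finset.sum_mul]
  refine Finset.sum_congr rfl fun j _ => ?_
  simp only [featureCov, featureOuter, Matrix.of_apply]
  ring

theorem ofReal_inner_featureCov (hσ : Continuous σ)
    (hR : ∀ᵐ x ∂ρ.fst, ‖featureMap σ W x‖ ^ 2 ≤ R) (v : EuclideanSpace ℝ (Fin m)) :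
    ENNReal.ofReal (inner ℝ v (Matrix.toEuclideanCLM (𝕜 := ℝ) (featureCov σ ρ W) v)) =
      ∫⁻ y, ENNReal.ofReal (inner ℝ (featureMap σ W y.1) v ^ 2) ∂ρ := by
  have hc : Continuous fun x => featureMap σ W x :=
    (continuous_featureMap hσ).comp (f := fun x => (W, x)) (by fun_prop)
  rw [inner_featureCov hσ hR, ofReal_integral_eq_lintegral_ofReal, Measure.fst, lintegral_map]
  · fun_prop
  · fun_prop
  · refine Integrable.of_bound (C := R * ‖v‖ ^ 2)
      (Continuous.aestronglyMeasurable (by fun_prop)) ?_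
    filter_upwards [hR] with x hx
    rw [Real.norm_of_nonneg (sq_nonneg _), ← sq_abs]
    calc _ ≤ (‖featureMap σ W x‖ * ‖v‖) ^ 2 := by
          gcongr; exact abs_real_inner_le_norm _ _
      _ = ‖featureMap σ W x‖ ^ 2 * ‖v‖ ^ 2 := by ring
      _ ≤ _ := by gcongr
  · exact Filter.Eventually.of_forall fun x => sq_nonneg _

theorem inner_featureCov_nonneg (hσ : Continuous σ)
    (hR : ∀ᵐ x ∂ρ.fst, ‖featureMap σ W x‖ ^ 2 ≤ R) (v : EuclideanSpace ℝ (Fin m)) :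
    0 ≤ inner ℝ v (Matrix.toEuclideanCLM (𝕜 := ℝ) (featureCov σ ρ W) v) := by
  rw [inner_featureCov hσ hR]
  exact integral_nonneg fun x => sq_nonneg _

theorem inner_featureCov_le (hσ : Continuous σ)
    (hR : ∀ᵐ x ∂ρ.fst, ‖featureMap σ W x‖ ^ 2 ≤ R) (v : EuclideanSpace ℝ (Fin m)) :
    inner ℝ v (Matrix.toEuclideanCLM (𝕜 := ℝ) (featureCov σ ρ W) v) ≤ R * ‖v‖ ^ 2 := by
  rw [inner_featureCov hσ hR]
  calc _ ≤ ∫ _, R * ‖v‖ ^ 2 ∂ρ.fst := by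
        refine integral_mono_of_nonneg (Filter.Eventually.of_forall fun x => sq_nonneg _)
          (integrable_const _) ?_
        filter_upwards [hR] with x hx
        rw [← sq_abs]
        calc _ ≤ (‖featureMap σ W x‖ * ‖v‖) ^ 2 := by
              gcongr; exact abs_real_inner_le_norm _ _
          _ = ‖featureMap σ W x‖ ^ 2 * ‖v‖ ^ 2 := by ring
          _ ≤ _ := by gcongr
    _ = _ := by simp

theorem ae_pi_of_ae_fst {n : ℕ} {P : EuclideanSpace ℝ (Fin d) → Prop} (h : ∀ᵐ x ∂ρ.fst, P x) :
    ∀ᵐ z ∂(Measure.pi fun _ : Fin n => ρ), ∀ i, P (z i).1 := by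
  rw [ae_all_iff]
  intro i
  have h1 : ∀ᵐ y ∂ρ, P y.1 := ae_of_ae_map measurable_fst.aemeasurable h
  exact (measurePreserving_eval (fun _ : Fin n => ρ) i).quasiMeasurePreserving.ae h1

end Covariance

/-! ### The loss conditionally on the weights. -/

theorem measurable_biasLoss_sample {n m d : ℕ} {σ : ℝ → ℝ}
    {ρ : Measure (EuclideanSpace ℝ (Fin d) × ℝ)} {W : Fin m → Fin d → ℝ} {γ₀ ζ : ℝ}
    {θstar : (Fin m → Fin d → ℝ) → EuclideanSpace ℝ (Fin m)} (hσ : Continuous σ) :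
    Measurable fun z : Fin n → EuclideanSpace ℝ (Fin d) × ℝ =>
      biasLoss σ ρ γ₀ ζ θstar (W, z) := by
  have h : ∀ t, Continuous fun z : Fin n → EuclideanSpace ℝ (Fin d) × ℝ =>
      biasIterate σ γ₀ ζ W (θstar W) z t := fun t =>
    (continuous_biasIterate hσ γ₀ ζ t).comp
      (f := fun z : Fin n → EuclideanSpace ℝ (Fin d) × ℝ => (W, θstar W, z)) (by fun_prop)
  have h2 : Continuous fun z : Fin n → EuclideanSpace ℝ (Fin d) × ℝ =>
      averagedBias σ γ₀ ζ W (θstar W) z := by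
    unfold averagedBias; fun_prop
  have h3 : Continuous fun v : EuclideanSpace ℝ (Fin m) => (inner ℝ v
      (Matrix.toEuclideanCLM (𝕜 := ℝ) (featureCov σ ρ W) v) : ℝ) := by fun_prop
  exact (h3.comp h2).measurable

section Loss

variable {n m d : ℕ} {σ : ℝ → ℝ} {ρ : Measure (EuclideanSpace ℝ (Fin d) × ℝ)}
  [IsProbabilityMeasure ρ] {W : Fin m → Fin d → ℝ} {R γ₀ ζ : ℝ}
  {θstar : (Fin m → Fin d → ℝ) → EuclideanSpace ℝ (Fin m)}

theorem biasLoss_nonneg (hσ : Continuous σ) (hR : ∀ᵐ x ∂ρ.fst, ‖featureMap σ W x‖ ^ 2 ≤ R)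
    (z : Fin n → EuclideanSpace ℝ (Fin d) × ℝ) : 0 ≤ biasLoss σ ρ γ₀ ζ θstar (W, z) :=
  inner_featureCov_nonneg hσ hR _

theorem biasLoss_le_exp (hσ : Continuous σ) (hn : 1 ≤ n) (hγ : 0 < γ₀) (hζ : 0 ≤ ζ) (hR0 : 0 ≤ R)
    (hR : ∀ᵐ x ∂ρ.fst, ‖featureMap σ W x‖ ^ 2 ≤ R)
    {z : Fin n → EuclideanSpace ℝ (Fin d) × ℝ}
    (hz : ∀ i, ‖featureMap σ W (z i).1‖ ^ 2 ≤ R) :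
    biasLoss σ ρ γ₀ ζ θstar (W, z) ≤ Real.exp (3 * n * (γ₀ * R)) / γ₀ * ‖θstar W‖ ^ 2 := by
  have hn0 : (0 : ℝ) < n := by exact_mod_cast hn
  have hx : 0 ≤ γ₀ * R := mul_nonneg hγ.le hR0
  have h1 : ‖averagedBias σ γ₀ ζ W (θstar W) z‖ ≤ Real.exp (n * (γ₀ * R)) * ‖θstar W‖ := by
    unfold averagedBias
    rw [norm_smul, Real.norm_of_nonneg (by positivity), one_div, inv_mul_le_iff₀ hn0]
    calc _ ≤ ∑ t ∈ Finset.range n, ‖biasIterate σ γ₀ ζ W (θstar W) z t‖ := norm_sum_le _ _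
      _ ≤ ∑ _t ∈ Finset.range n, Real.exp (n * (γ₀ * R)) * ‖θstar W‖ := by
          refine Finset.sum_le_sum fun t ht => ?_
          refine (norm_biasIterate_le hγ.le hζ hR0 hz t).trans ?_
          gcongr
          rw [Real.exp_nat_mul]
          calc _ ≤ (1 + γ₀ * R) ^ n := by
                gcongr
                · linarith
                · exact (Finset.mem_range.1 ht).le
            _ ≤ _ := by
                gcongr
                linarith [Real.add_one_le_exp (γ₀ * R)]
      _ = _ := by simp
  -- The prefactor `R` becomes a third copy of the exponential, next to the two from `‖η̄‖²`.
  have h2 : R ≤ Real.exp (n * (γ₀ * R)) / γ₀ := by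
    rw [le_div_iff₀ hγ]
    have h3 := Real.add_one_le_exp (n * (γ₀ * R))
    have : (1 : ℝ) ≤ n := by exact_mod_cast hn
    nlinarith
  calc _ ≤ R * ‖averagedBias σ γ₀ ζ W (θstar W) z‖ ^ 2 := inner_featureCov_le hσ hR _
    _ ≤ Real.exp (n * (γ₀ * R)) / γ₀ * (Real.exp (n * (γ₀ * R)) * ‖θstar W‖) ^ 2 := by gcongr
    _ = Real.exp (n * (γ₀ * R)) ^ 3 / γ₀ * ‖θstar W‖ ^ 2 := by ring
    _ = _ := by rw [← Real.exp_nat_mul]; push_cast; ring_nf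

theorem inner_averagedBias_sq_le (hn : 1 ≤ n) (v : EuclideanSpace ℝ (Fin m))
    (z : Fin n → EuclideanSpace ℝ (Fin d) × ℝ) :
    (inner ℝ v (averagedBias σ γ₀ ζ W (θstar W) z) : ℝ) ^ 2 ≤
      ∑ t : Fin n, 1 / (n : ℝ) * inner ℝ v (biasIterate σ γ₀ ζ W (θstar W) z t) ^ 2 := by
  have hn0 : (0 : ℝ) < n := by exact_mod_cast hn
  rw [averagedBias, inner_smul_right, inner_sum, ← Finset.mul_sum, Finset.sum_range, mul_pow]
  have := sq_sum_le_card_mul_sum_sq (s := Finset.univ) (f := fun t : Fin n =>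
    (inner ℝ v (biasIterate σ γ₀ ζ W (θstar W) z t) : ℝ))
  rw [Finset.card_univ, Fintype.card_fin] at this
  refine (mul_le_mul_of_nonneg_left this (by positivity)).trans (le_of_eq ?_)
  field_simp

/-- The quadratic form is an expectation over a new data point `y`. After convexity splits the
average, `y` may be replaced in the `t`-th term by the sample point `z t`, which iterate `t` has not
seen. This produces the sum controlled pathwise. -/
theorem lintegral_biasLoss_le (hσ : Continuous σ) (hn : 1 ≤ n)
    (hR : ∀ᵐ x ∂ρ.fst, ‖featureMap σ W x‖ ^ 2 ≤ R) :
    ∫⁻ z, ENNReal.ofReal (biasLoss (n := n) σ ρ γ₀ ζ θstar (W, z)) ∂(Measure.pi fun _ => ρ) ≤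
      ∫⁻ z, ∑ t : Fin n, ENNReal.ofReal (1 / (n : ℝ) *
        inner ℝ (featureMap σ W (z t).1) (biasIterate σ γ₀ ζ W (θstar W) z t) ^ 2)
          ∂(Measure.pi fun _ => ρ) := by
  have hη : ∀ t, Continuous fun z : Fin n → EuclideanSpace ℝ (Fin d) × ℝ =>
      biasIterate σ γ₀ ζ W (θstar W) z t := fun t =>
    (continuous_biasIterate hσ γ₀ ζ t).comp
      (f := fun z : Fin n → EuclideanSpace ℝ (Fin d) × ℝ => (W, θstar W, z)) (by fun_prop)
  have hφ : Continuous fun y : EuclideanSpace ℝ (Fin d) × ℝ => featureMap σ W y.1 :=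
    (continuous_featureMap hσ).comp
      (f := fun y : EuclideanSpace ℝ (Fin d) × ℝ => (W, y.1)) (by fun_prop)
  rw [← lintegral_pi_sum_eval_eq ρ (f := fun (t : Fin n) z y => ENNReal.ofReal (1 / (n : ℝ) *
    inner ℝ (featureMap σ W y.1) (biasIterate σ γ₀ ζ W (θstar W) z t) ^ 2))]
  · refine lintegral_mono fun z => ?_
    unfold biasLoss
    rw [ofReal_inner_featureCov hσ hR]
    refine lintegral_mono fun y => ?_
    rw [← ENNReal.ofReal_sum_of_nonneg fun t _ => by positivity]
    exact ENNReal.ofReal_le_ofReal (inner_averagedBias_sq_le hn _ _)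
  · intro t
    refine ENNReal.measurable_ofReal.comp (Continuous.measurable ?_)
    have h1 := (hη t).comp (continuous_fst
      (X := Fin n → EuclideanSpace ℝ (Fin d) × ℝ) (Y := EuclideanSpace ℝ (Fin d) × ℝ))
    have h2 := hφ.comp (continuous_snd
      (X := Fin n → EuclideanSpace ℝ (Fin d) × ℝ) (Y := EuclideanSpace ℝ (Fin d) × ℝ))
    simp only [Function.comp_def] at h1 h2
    fun_prop
  · intro t z y y'
    rw [biasIterate_congr σ γ₀ ζ W (θstar W) (z := Function.update z t y') (z' := z)]
    intro i hi
    rw [Function.update_of_ne]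
    rintro rfl
    exact lt_irrefl _ hi

theorem integral_biasLoss_le_of_mul_le_one (hσ : Continuous σ) (hn : 1 ≤ n) (hγ : 0 < γ₀)
    (hζ : 0 ≤ ζ) (hR : ∀ᵐ x ∂ρ.fst, ‖featureMap σ W x‖ ^ 2 ≤ R) (hγR : γ₀ * R ≤ 1) :
    ∫ z, biasLoss (n := n) σ ρ γ₀ ζ θstar (W, z) ∂(Measure.pi fun _ => ρ) ≤
      (n : ℝ) ^ (ζ - 1) / γ₀ * ‖θstar W‖ ^ 2 := by
  have hn0 : (0 : ℝ) < n := by exact_mod_cast hn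
  rw [integral_eq_lintegral_of_nonneg_ae
    (Filter.Eventually.of_forall fun z => biasLoss_nonneg hσ hR z)
    (measurable_biasLoss_sample hσ).aestronglyMeasurable]
  refine ENNReal.toReal_le_of_le_ofReal (by positivity)
    ((lintegral_biasLoss_le hσ hn hR).trans ?_)
  have hc : ∫⁻ _, ENNReal.ofReal ((n : ℝ) ^ (ζ - 1) / γ₀ * ‖θstar W‖ ^ 2)
      ∂(Measure.pi fun _ : Fin n => ρ) =
      ENNReal.ofReal ((n : ℝ) ^ (ζ - 1) / γ₀ * ‖θstar W‖ ^ 2) := by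
    rw [lintegral_const, measure_univ, mul_one]
  rw [← hc]
  refine lintegral_mono_ae ?_
  filter_upwards [ae_pi_of_ae_fst (n := n) hR] with z hz
  rw [← ENNReal.ofReal_sum_of_nonneg fun t _ => by positivity]
  refine ENNReal.ofReal_le_ofReal ?_
  have := sum_inner_sq_biasIterate_le (θ := θstar W) hγ.le hζ hz hγR
  rw [← Finset.mul_sum]
  rw [Real.rpow_neg hn0.le] at this
  rw [Real.rpow_sub_one hn0.ne']
  have hp : (0 : ℝ) < (n : ℝ) ^ ζ := by positivity
  rw [one_div, inv_mul_le_iff₀ hn0]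
  have h2 : (n : ℝ) * ((n : ℝ) ^ ζ / n / γ₀ * ‖θstar W‖ ^ 2) =
      (n : ℝ) ^ ζ / γ₀ * ‖θstar W‖ ^ 2 := by field_simp
  rw [h2]
  refine le_trans (le_of_eq ?_) (mul_le_mul_of_nonneg_left this (div_nonneg hp.le hγ.le))
  rw [← mul_assoc, show (n : ℝ) ^ ζ / γ₀ * (γ₀ * ((n : ℝ) ^ ζ)⁻¹) = 1 by field_simp, one_mul]

/-- Adding the bounds for the stable and unstable regimes removes the case distinction, so the
result can be integrated over `W`. The free parameter `T` is a Chernoff tilt. -/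
theorem integral_biasLoss_le (hσ : Continuous σ) (hn : 1 ≤ n) (hγ : 0 < γ₀)
    (hζ : 0 ≤ ζ) (hR0 : 0 ≤ R) (hR : ∀ᵐ x ∂ρ.fst, ‖featureMap σ W x‖ ^ 2 ≤ R) {T : ℝ}
    (hT : 0 ≤ T) :
    ∫ z, biasLoss (n := n) σ ρ γ₀ ζ θstar (W, z) ∂(Measure.pi fun _ => ρ) ≤
      ((n : ℝ) ^ (ζ - 1) / γ₀ + Real.exp (n * ((3 + T) * (γ₀ * R) - T)) / γ₀) *
        ‖θstar W‖ ^ 2 := by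
  rw [add_mul]
  rcases le_or_gt (γ₀ * R) 1 with h | h
  · have := integral_biasLoss_le_of_mul_le_one (n := n) (θstar := θstar) hσ hn hγ hζ hR h
    have h2 : 0 ≤ Real.exp (n * ((3 + T) * (γ₀ * R) - T)) / γ₀ * ‖θstar W‖ ^ 2 := by positivity
    linarith
  · have h1 : 0 ≤ (n : ℝ) ^ (ζ - 1) / γ₀ * ‖θstar W‖ ^ 2 := by positivity
    refine le_trans ?_ (le_add_of_nonneg_left h1)
    calc _ ≤ ∫ _, Real.exp (n * ((3 + T) * (γ₀ * R) - T)) / γ₀ * ‖θstar W‖ ^ 2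
          ∂(Measure.pi fun _ : Fin n => ρ) := by
          refine integral_mono_of_nonneg
            (Filter.Eventually.of_forall fun z => biasLoss_nonneg hσ hR z)
            (integrable_const _) ?_
          filter_upwards [ae_pi_of_ae_fst (n := n) hR] with z hz
          refine (biasLoss_le_exp hσ hn hγ hζ hR0 hR hz).trans ?_
          gcongr ?_ / _ * _
          rw [Real.exp_le_exp]
          -- In the unstable regime the factor `exp(nT(γ₀R - 1))` is at least 1 and can be inserted
          -- for free.
          have : 0 ≤ (n : ℝ) * (T * (γ₀ * R - 1)) :=
            mul_nonneg (by positivity) (mul_nonneg hT (by linarith))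
          linarith
      _ = _ := by simp

theorem aestronglyMeasurable_biasLoss (hσ : Continuous σ)
    (hθ : AEStronglyMeasurable θstar (gaussianWeights m d)) :
    AEStronglyMeasurable (biasLoss (n := n) σ ρ γ₀ ζ θstar) (jointLaw n m ρ) := by
  have hθ' : AEStronglyMeasurable (fun p : (Fin m → Fin d → ℝ) ×
      (Fin n → EuclideanSpace ℝ (Fin d) × ℝ) => θstar p.1) (jointLaw n m ρ) := hθ.comp_fst
  have hη : ∀ t, AEStronglyMeasurable (fun p : (Fin m → Fin d → ℝ) ×
      (Fin n → EuclideanSpace ℝ (Fin d) × ℝ) => biasIterate σ γ₀ ζ p.1 (θstar p.1) p.2 t)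
      (jointLaw n m ρ) := fun t =>
    (continuous_biasIterate hσ γ₀ ζ t).comp_aestronglyMeasurable
      (continuous_fst.aestronglyMeasurable.prodMk
        (hθ'.prodMk continuous_snd.aestronglyMeasurable))
  have hη' : AEStronglyMeasurable (fun p : (Fin m → Fin d → ℝ) ×
      (Fin n → EuclideanSpace ℝ (Fin d) × ℝ) => averagedBias σ γ₀ ζ p.1 (θstar p.1) p.2)
      (jointLaw n m ρ) := by
    unfold averagedBias
    exact (Finset.aestronglyMeasurable_fun_sum (Finset.range n) fun t _ => hη t).const_smul
      (1 / (n : ℝ))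
  have hφ := continuous_featureMap (m := m) (d := d) hσ
  have h_cov : ∀ i j, Measurable fun W : Fin m → Fin d → ℝ => featureCov σ ρ W i j := by
    intro i j
    unfold featureCov featureOuter
    refine (StronglyMeasurable.integral_prod_right (ν := ρ.fst)
      (f := fun (W : Fin m → Fin d → ℝ) x => featureMap σ W x i * featureMap σ W x j)
      (Continuous.stronglyMeasurable ?_)).measurable
    simp only [Function.uncurry_def]
    fun_prop
  have he : biasLoss (n := n) σ ρ γ₀ ζ θstar = fun p => ∑ i, ∑ j, featureCov σ ρ p.1 i j *
      averagedBias σ γ₀ ζ p.1 (θstar p.1) p.2 j * averagedBias σ γ₀ ζ p.1 (θstar p.1) p.2 i := by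
    ext p
    rw [biasLoss, PiLp.inner_apply]
    refine Finset.sum_congr rfl fun i _ => ?_
    simp only [RCLike.inner_apply, conj_trivial, Matrix.ofLp_toEuclideanCLM, Matrix.mulVec,
      dotProduct, Finset.sum_mul]
  rw [he]
  refine Finset.aestronglyMeasurable_fun_sum _ fun i _ =>
    Finset.aestronglyMeasurable_fun_sum _ fun j _ => ?_
  have hc : ∀ k : Fin m, AEStronglyMeasurable (fun p : (Fin m → Fin d → ℝ) ×
      (Fin n → EuclideanSpace ℝ (Fin d) × ℝ) => averagedBias σ γ₀ ζ p.1 (θstar p.1) p.2 k)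
      (jointLaw n m ρ) := fun k =>
    Continuous.comp_aestronglyMeasurable
      (g := fun v : EuclideanSpace ℝ (Fin m) => v k) (by fun_prop) hη'
  exact ((((h_cov i j).comp measurable_fst).aestronglyMeasurable).mul (hc j)).mul (hc i)

end Loss

/-! ### Consequences of the Lipschitz and high-dimensional assumptions for the features. -/

theorem LipschitzWith.sq_le {σ : ℝ → ℝ} {L : NNReal} (hL : LipschitzWith L σ) (s : ℝ) :
    σ s ^ 2 ≤ 2 * σ 0 ^ 2 + 2 * (L : ℝ) ^ 2 * s ^ 2 := by
  have h := hL.dist_le_mul s 0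
  rw [Real.dist_eq, Real.dist_eq, sub_zero] at h
  have h2 := pow_le_pow_left₀ (abs_nonneg _) h 2
  rw [sq_abs, mul_pow, sq_abs] at h2
  nlinarith [sq_nonneg (σ s - 2 * σ 0)]

theorem HighDimensional.constants_pos {c C : ℝ} (hc : 0 < c) {n m d : ℕ} (hn : 1 ≤ n)
    {ρ : Measure (EuclideanSpace ℝ (Fin d) × ℝ)} (h : HighDimensional c C n m d ρ) :
    0 < C ∧ (0 : ℝ) < d ∧ (0 : ℝ) < m := by
  have hn0 : (0 : ℝ) < n := by exact_mod_cast hn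
  have h1 : (0 : ℝ) < d := (mul_pos hc hn0).trans_le h.dim_lower
  exact ⟨pos_of_mul_pos_left (h1.trans_le h.dim_upper) hn0.le, h1,
    (mul_pos hc hn0).trans_le h.features_lower⟩

theorem featureMap_apply_sq {m d : ℕ} (σ : ℝ → ℝ) (W : Fin m → Fin d → ℝ)
    (x : EuclideanSpace ℝ (Fin d)) (i : Fin m) :
    featureMap σ W x i * featureMap σ W x i =
      (m : ℝ)⁻¹ * σ ((∑ j, W i j * x j) / √(d : ℝ)) ^ 2 := by
  simp only [featureMap]
  have h : (1 / √(m : ℝ)) * (1 / √(m : ℝ)) = (m : ℝ)⁻¹ := by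
    rw [one_div_mul_one_div, Real.mul_self_sqrt (Nat.cast_nonneg _), one_div]
  rw [← h]; ring

theorem norm_featureMap_sq_le {m d : ℕ} {σ : ℝ → ℝ} {L : NNReal} (hL : LipschitzWith L σ)
    (hm : (0 : ℝ) < m) (hd : (0 : ℝ) < d) {C : ℝ} (W : Fin m → Fin d → ℝ)
    {x : EuclideanSpace ℝ (Fin d)} (hx : ‖x‖ ^ 2 ≤ C * d) :
    ‖featureMap σ W x‖ ^ 2 ≤ 2 * σ 0 ^ 2 + 2 * (L : ℝ) ^ 2 * C * (weightNorm W ^ 2 / m) := by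
  rw [EuclideanSpace.norm_sq_eq]
  simp only [Real.norm_eq_abs, sq_abs]
  simp only [sq (featureMap σ W x _), featureMap_apply_sq]
  rw [← Finset.mul_sum, inv_mul_le_iff₀ hm]
  calc _ ≤ ∑ i : Fin m, (2 * σ 0 ^ 2 + 2 * (L : ℝ) ^ 2 * ((∑ j, W i j * x j) / √(d : ℝ)) ^ 2) :=
        Finset.sum_le_sum fun i _ => hL.sq_le _
    _ = m * (2 * σ 0 ^ 2) + 2 * (L : ℝ) ^ 2 * ((∑ i, (∑ j, W i j * x j) ^ 2) / d) := by
        simp only [div_pow, Real.sq_sqrt hd.le]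
        rw [Finset.sum_add_distrib, ← Finset.mul_sum Finset.univ _ (2 * (L : ℝ) ^ 2),
          ← Finset.sum_div]
        simp
    _ ≤ m * (2 * σ 0 ^ 2) + 2 * (L : ℝ) ^ 2 * (weightNorm W ^ 2 * C) := by
        gcongr
        rw [div_le_iff₀ hd, mul_assoc]
        refine (sum_sq_weights_mul_le W x).trans ?_
        gcongr
    _ = _ := by field_simp

/-! ### The trace of the expected feature covariance. -/

section Trace

/-- The second moment of `σ` under a centered Gaussian with standard deviation `s`. -/
noncomputable def gaussianSecondMoment (σ : ℝ → ℝ) (s : ℝ) : ℝ :=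
  ∫ z, σ (s * z) ^ 2 ∂(gaussianReal 0 1)

variable {σ : ℝ → ℝ} {L : NNReal}

theorem integrable_sq_gaussianReal : Integrable (fun z : ℝ => z ^ 2) (gaussianReal 0 1) := by
  have := (memLp_id_gaussianReal (μ := 0) (v := 1) 2).integrable_sq
  simpa using this

theorem gaussianSecondMoment_le (hL : LipschitzWith L σ) (s : ℝ) :
    gaussianSecondMoment σ s ≤
      2 * σ 0 ^ 2 + 2 * (L : ℝ) ^ 2 * (∫ z, z ^ 2 ∂(gaussianReal 0 1)) * s ^ 2 := by
  unfold gaussianSecondMoment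
  calc _ ≤ ∫ z, (2 * σ 0 ^ 2 + 2 * (L : ℝ) ^ 2 * s ^ 2 * z ^ 2) ∂(gaussianReal 0 1) := by
        refine integral_mono_of_nonneg (Filter.Eventually.of_forall fun z => sq_nonneg _)
          ((integrable_const _).add (integrable_sq_gaussianReal.const_mul _))
          (Filter.Eventually.of_forall fun z => ?_)
        refine (hL.sq_le _).trans (le_of_eq ?_)
        ring
    _ = _ := by
        rw [integral_add (integrable_const _) (integrable_sq_gaussianReal.const_mul _),
          integral_const, integral_const_mul, probReal_univ, one_smul]
        ring

theorem integrable_sq_comp_mul_gaussianReal (hL : LipschitzWith L σ) (s : ℝ) :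
    Integrable (fun z => σ (s * z) ^ 2) (gaussianReal 0 1) := by
  have hc := hL.continuous
  refine Integrable.mono' (g := fun z => 2 * σ 0 ^ 2 + 2 * (L : ℝ) ^ 2 * s ^ 2 * z ^ 2)
    ((integrable_const _).add (integrable_sq_gaussianReal.const_mul _))
    (Continuous.aestronglyMeasurable (by fun_prop)) (Filter.Eventually.of_forall fun z => ?_)
  rw [Real.norm_of_nonneg (sq_nonneg _)]
  refine (hL.sq_le _).trans (le_of_eq ?_)
  ring

theorem continuousOn_gaussianSecondMoment (hL : LipschitzWith L σ) (M : ℝ) :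
    ContinuousOn (gaussianSecondMoment σ) (Set.Icc 0 M) := by
  have hc := hL.continuous
  unfold gaussianSecondMoment
  refine continuousOn_of_dominated
    (bound := fun z => 2 * σ 0 ^ 2 + 2 * (L : ℝ) ^ 2 * M ^ 2 * z ^ 2) ?_ ?_ ?_ ?_
  · exact fun s _ => Continuous.aestronglyMeasurable (by fun_prop)
  · intro s hs
    refine Filter.Eventually.of_forall fun z => ?_
    rw [Real.norm_of_nonneg (sq_nonneg _)]
    refine (hL.sq_le _).trans ?_
    have := pow_le_pow_left₀ hs.1 hs.2 2
    rw [mul_pow, ← mul_assoc]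
    gcongr
  · exact (integrable_const _).add (integrable_sq_gaussianReal.const_mul _)
  · exact Filter.Eventually.of_forall fun z => Continuous.continuousOn (by fun_prop)

/-- A continuous nonzero `σ` is nonzero on a nonempty open set, and nondegenerate Gaussians charge
open sets. -/
theorem gaussianSecondMoment_pos (hL : LipschitzWith L σ) (hσ : σ ≠ 0) {s : ℝ} (hs : 0 < s) :
    0 < gaussianSecondMoment σ s := by
  have hc := hL.continuous
  unfold gaussianSecondMoment
  rw [integral_pos_iff_support_of_nonneg (fun z => sq_nonneg _)
    (integrable_sq_comp_mul_gaussianReal hL s), pos_iff_ne_zero]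
  intro h0
  have h1 := gaussianReal_absolutelyContinuous' 0 one_ne_zero h0
  have hopen : IsOpen (Function.support fun z => σ (s * z) ^ 2) :=
    Continuous.isOpen_support (by fun_prop)
  rw [hopen.measure_eq_zero_iff volume] at h1
  obtain ⟨u, hu⟩ := Function.ne_iff.1 hσ
  have : u / s ∈ Function.support fun z => σ (s * z) ^ 2 := by
    rw [Function.mem_support, mul_div_cancel₀ _ hs.ne']
    exact pow_ne_zero _ hu
  rw [h1] at this
  exact this

theorem exists_le_gaussianSecondMoment (hL : LipschitzWith L σ) (hσ : σ ≠ 0) {s M : ℝ}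
    (hs : 0 < s) : ∃ κ : ℝ, 0 < κ ∧ ∀ u ∈ Set.Icc s M, κ ≤ gaussianSecondMoment σ u := by
  rcases (Set.Icc s M).eq_empty_or_nonempty with h | h
  · exact ⟨1, one_pos, by simp [h]⟩
  · obtain ⟨u, hu, hmin⟩ := isCompact_Icc.exists_isMinOn h
      ((continuousOn_gaussianSecondMoment hL M).mono (Set.Icc_subset_Icc_left hs.le))
    exact ⟨_, gaussianSecondMoment_pos hL hσ (hs.trans_le hu.1), fun v hv => hmin hv⟩

variable {c C : ℝ} {n m d : ℕ} {ρ : Measure (EuclideanSpace ℝ (Fin d) × ℝ)}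
  [IsProbabilityMeasure ρ]

theorem integrable_weight_sq (i : Fin m) (j : Fin d) :
    Integrable (fun W : Fin m → Fin d → ℝ => W i j ^ 2) (gaussianWeights m d) := by
  have h1 := (measurePreserving_eval (fun _ : Fin d => gaussianReal 0 1) j).integrable_comp_of_integrable
    integrable_sq_gaussianReal
  exact (measurePreserving_eval (fun _ : Fin m =>
    Measure.pi fun _ : Fin d => gaussianReal 0 1) i).integrable_comp_of_integrable h1

theorem integrable_featureMap_mul_self_prod (hL : LipschitzWith L σ) (hd : (0 : ℝ) < d)
    (hx : ∀ᵐ x ∂ρ.fst, ‖x‖ ^ 2 ≤ C * d) (i : Fin m) :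
    Integrable (fun p : (Fin m → Fin d → ℝ) × EuclideanSpace ℝ (Fin d) =>
      featureMap σ p.1 p.2 i * featureMap σ p.1 p.2 i) ((gaussianWeights m d).prod ρ.fst) := by
  have hφ := continuous_featureMap (m := m) (d := d) hL.continuous
  have hφi : Continuous fun p : (Fin m → Fin d → ℝ) × EuclideanSpace ℝ (Fin d) =>
      featureMap σ p.1 p.2 i := (by fun_prop : Continuous fun v : EuclideanSpace ℝ (Fin m) =>
        v i).comp hφ
  have hg : Integrable (fun W : Fin m → Fin d → ℝ =>
      (m : ℝ)⁻¹ * (2 * σ 0 ^ 2 + 2 * (L : ℝ) ^ 2 * C * ∑ j, W i j ^ 2)) (gaussianWeights m d) :=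
    ((integrable_const _).add ((integrable_finsetSum _ fun j _ =>
      integrable_weight_sq i j).const_mul _)).const_mul _
  refine Integrable.mono' (hg.comp_fst ρ.fst) (hφi.mul hφi).aestronglyMeasurable ?_
  filter_upwards [Measure.quasiMeasurePreserving_snd.ae hx] with p hp
  rw [Real.norm_of_nonneg (mul_self_nonneg _), featureMap_apply_sq]
  gcongr
  refine (hL.sq_le _).trans ?_
  rw [add_le_add_iff_left, mul_assoc _ C]
  gcongr
  rw [div_pow, Real.sq_sqrt hd.le, div_le_iff₀ hd]
  calc _ ≤ (∑ j, p.1 i j ^ 2) * ∑ j, p.2 j ^ 2 := Finset.sum_mul_sq_le_sq_mul_sq _ _ _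
    _ = (∑ j, p.1 i j ^ 2) * ‖p.2‖ ^ 2 := by rw [EuclideanSpace.real_norm_sq_eq]
    _ ≤ (∑ j, p.1 i j ^ 2) * (C * d) := by gcongr
    _ = _ := by ring

theorem integral_weights_featureMap_mul_self (hL : LipschitzWith L σ)
    (x : EuclideanSpace ℝ (Fin d)) (i : Fin m) :
    ∫ W, featureMap σ W x i * featureMap σ W x i ∂(gaussianWeights m d) =
      (m : ℝ)⁻¹ * gaussianSecondMoment σ (‖x‖ / √(d : ℝ)) := by
  have hc := hL.continuous
  simp_rw [featureMap_apply_sq]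
  rw [integral_const_mul, integral_weights_row x i (f := fun s => σ (s / √(d : ℝ)) ^ 2)
    (by fun_prop)]
  simp only [gaussianSecondMoment, div_mul_eq_mul_div]

theorem integrable_gaussianSecondMoment (hL : LipschitzWith L σ) (hm : (0 : ℝ) < m)
    (hd : (0 : ℝ) < d) (hx : ∀ᵐ x ∂ρ.fst, ‖x‖ ^ 2 ≤ C * d) :
    Integrable (fun x => gaussianSecondMoment σ (‖x‖ / √(d : ℝ))) ρ.fst := by
  have h := (integrable_featureMap_mul_self_prod (m := m) hL hd hx
    ⟨0, by exact_mod_cast hm⟩).integral_prod_right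
  simp only [integral_weights_featureMap_mul_self hL] at h
  have := h.const_mul (m : ℝ)
  simpa [← mul_assoc, mul_inv_cancel₀ hm.ne'] using this

theorem trace_expectedFeatureCov (hL : LipschitzWith L σ) (hm : (0 : ℝ) < m)
    (hd : (0 : ℝ) < d) (hx : ∀ᵐ x ∂ρ.fst, ‖x‖ ^ 2 ≤ C * d) :
    (expectedFeatureCov σ ρ m).trace =
      ∫ x, gaussianSecondMoment σ (‖x‖ / √(d : ℝ)) ∂ρ.fst := by
  have h : ∀ i : Fin m, expectedFeatureCov σ ρ m i i =
      (m : ℝ)⁻¹ * ∫ x, gaussianSecondMoment σ (‖x‖ / √(d : ℝ)) ∂ρ.fst := by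
    intro i
    simp only [expectedFeatureCov, featureCov, featureOuter, Matrix.of_apply]
    rw [integral_integral_swap (integrable_featureMap_mul_self_prod hL hd hx i)]
    simp only [integral_weights_featureMap_mul_self hL]
    rw [integral_const_mul]
  simp [Matrix.trace, h, ← mul_assoc, mul_inv_cancel₀ hm.ne']

theorem HighDimensional.trace_le (hL : LipschitzWith L σ) (hc : 0 < c) (hn : 1 ≤ n)
    (h : HighDimensional c C n m d ρ) :
    (expectedFeatureCov σ ρ m).trace ≤
      2 * σ 0 ^ 2 + 2 * (L : ℝ) ^ 2 * (∫ z, z ^ 2 ∂(gaussianReal 0 1)) * C := by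
  obtain ⟨_, hd, hm⟩ := h.constants_pos hc hn
  rw [trace_expectedFeatureCov hL hm hd h.norm_upper]
  have hV : 0 ≤ ∫ z, z ^ 2 ∂(gaussianReal 0 1) := integral_nonneg fun z => sq_nonneg _
  calc _ ≤ ∫ _, (2 * σ 0 ^ 2 + 2 * (L : ℝ) ^ 2 * (∫ z, z ^ 2 ∂(gaussianReal 0 1)) * C)
        ∂ρ.fst := by
        refine integral_mono_ae (integrable_gaussianSecondMoment hL hm hd h.norm_upper)
          (integrable_const _) ?_
        filter_upwards [h.norm_upper] with x hx
        refine (gaussianSecondMoment_le hL _).trans ?_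
        gcongr
        rw [div_pow, Real.sq_sqrt hd.le, div_le_iff₀ hd]
        exact hx
    _ = _ := by simp

/-- A reverse Markov inequality: `‖x‖²/d` lies in `[0, C]` and has mean at least `c`, so it exceeds
`c/2` with probability bounded below. On that event the Gaussian second moment is at least its
minimum `κ` over a compact interval away from 0. -/
theorem exists_le_trace_expectedFeatureCov (hL : LipschitzWith L σ) (hσ : σ ≠ 0) (hc : 0 < c)
    (C : ℝ) : ∃ a : ℝ, 0 < a ∧ ∀ (n m d : ℕ) (_ : 1 ≤ n)
      (ρ : Measure (EuclideanSpace ℝ (Fin d) × ℝ)) (_ : IsProbabilityMeasure ρ),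
      HighDimensional c C n m d ρ → a ≤ (expectedFeatureCov σ ρ m).trace := by
  rcases le_or_gt C 0 with hC | hC
  · exact ⟨1, one_pos, fun n m d hn ρ _ h => absurd (h.constants_pos hc hn).1 hC.not_gt⟩
  obtain ⟨κ, hκ, hκ'⟩ := exists_le_gaussianSecondMoment hL hσ (s := √(c / 2)) (M := √C)
    (by positivity)
  refine ⟨κ / C * (c / 2), by positivity, fun n m d hn ρ _ h => ?_⟩
  obtain ⟨_, hd, hm⟩ := h.constants_pos hc hn
  rw [trace_expectedFeatureCov hL hm hd h.norm_upper]
  have hint : Integrable (fun x : EuclideanSpace ℝ (Fin d) => ‖x‖ ^ 2) ρ.fst := by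
    refine Integrable.of_bound (C := C * d) (Continuous.aestronglyMeasurable (by fun_prop)) ?_
    filter_upwards [h.norm_upper] with x hx
    rwa [Real.norm_of_nonneg (sq_nonneg _)]
  calc κ / C * (c / 2) ≤ κ / C * ((∫ x, ‖x‖ ^ 2 ∂ρ.fst) / d - c / 2) := by
        gcongr
        have := (le_div_iff₀ hd).2 h.norm_lower
        linarith
    _ = ∫ x, κ / C * (‖x‖ ^ 2 / d - c / 2) ∂ρ.fst := by
        rw [integral_const_mul, integral_sub (hint.div_const _) (integrable_const _),
          integral_div]
        simp
    _ ≤ _ := by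
        refine integral_mono_ae (((hint.div_const _).sub (integrable_const _)).const_mul _)
          (integrable_gaussianSecondMoment hL hm hd h.norm_upper) ?_
        filter_upwards [h.norm_upper] with x hx
        have hle : ‖x‖ ^ 2 / d ≤ C := by rwa [div_le_iff₀ hd]
        have he : ‖x‖ / √(d : ℝ) = √(‖x‖ ^ 2 / d) := by
          rw [Real.sqrt_div (sq_nonneg _), Real.sqrt_sq (norm_nonneg _)]
        -- The affine minorant is at most `κ` above the threshold `c/2` and nonpositive below it.
        rcases le_or_gt (c / 2) (‖x‖ ^ 2 / d) with h1 | h1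
        · refine le_trans ?_ (hκ' _ ⟨?_, ?_⟩)
          · rw [div_mul_eq_mul_div, div_le_iff₀ hC]
            gcongr
            linarith
          · rw [he]; exact Real.sqrt_le_sqrt h1
          · rw [he]; exact Real.sqrt_le_sqrt hle
        · refine le_trans ?_ (integral_nonneg fun z => sq_nonneg _)
          exact mul_nonpos_of_nonneg_of_nonpos (by positivity) (by linarith)

end Trace

/-! ### Integration over the weights. -/

theorem integral_mul_le_sqrt_mul_sqrt {α : Type*} [MeasurableSpace α] {μ : Measure α}
    {f g : α → ℝ} (hf0 : 0 ≤ f) (hg0 : 0 ≤ g) (hf : MemLp f 2 μ) (hg : MemLp g 2 μ) :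
    ∫ a, f a * g a ∂μ ≤ √(∫ a, f a ^ 2 ∂μ) * √(∫ a, g a ^ 2 ∂μ) := by
  have h := integral_mul_le_Lp_mul_Lq_of_nonneg (μ := μ) (p := 2) (q := 2)
    Real.HolderConjugate.two_two (Filter.Eventually.of_forall hf0)
    (Filter.Eventually.of_forall hg0) (by simpa using hf) (by simpa using hg)
  simpa [Real.sqrt_eq_rpow] using h

theorem integrable_exp_weightNorm_and_integral_le {D : ℝ} (hD : 1 ≤ D) {m d : ℕ}
    (h : ∫⁻ W, ENNReal.ofReal (Real.exp (weightNorm W ^ 2 / 25)) ∂(gaussianWeights m d) ≤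
        ENNReal.ofReal (5 ^ d * D ^ m)) :
    Integrable (fun W => Real.exp (weightNorm W ^ 2 / 25)) (gaussianWeights m d) ∧
      ∫ W, Real.exp (weightNorm W ^ 2 / 25) ∂(gaussianWeights m d) ≤ 5 ^ d * D ^ m := by
  have hc := continuous_weightNorm (m := m) (d := d)
  have hm : AEStronglyMeasurable (fun W => Real.exp (weightNorm W ^ 2 / 25))
      (gaussianWeights m d) := Continuous.aestronglyMeasurable (by fun_prop)
  have h0 : 0 ≤ᵐ[gaussianWeights m d] fun W => Real.exp (weightNorm W ^ 2 / 25) :=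
    Filter.Eventually.of_forall fun W => by positivity
  constructor
  · rw [← lintegral_ofReal_ne_top_iff_integrable hm h0]
    exact (h.trans_lt ENNReal.ofReal_lt_top).ne
  · rw [integral_eq_lintegral_of_nonneg_ae h0 hm]
    exact ENNReal.toReal_le_of_le_ofReal (by positivity) h

/-- The conditional bound has the form `(k + G W)‖f*‖²`, with `k` the desired rate and `G` the
unstable contribution. The constants are tuned so that `G` has `L²` norm at most `k`. -/
theorem exists_stepSize_bound {σ : ℝ → ℝ} {L : NNReal} (hL : LipschitzWith L σ) {c C : ℝ}
    (hc : 0 < c) (hC : 0 < C) :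
    ∃ c₁ : ℝ, 0 < c₁ ∧ ∀ (n m d : ℕ) (_ : 1 ≤ n) (ρ : Measure (EuclideanSpace ℝ (Fin d) × ℝ))
      (_ : IsProbabilityMeasure ρ) (_ : HighDimensional c C n m d ρ)
      (ζ : ℝ) (_ : 0 ≤ ζ) (γ₀ : ℝ) (_ : 0 < γ₀) (_ : γ₀ ≤ c₁)
      (θstar : (Fin m → Fin d → ℝ) → EuclideanSpace ℝ (Fin m))
      (_ : MemLp θstar 4 (gaussianWeights m d)),
      Integrable (biasLoss (n := n) σ ρ γ₀ ζ θstar) (jointLaw n m ρ) ∧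
      bias n σ ρ γ₀ ζ θstar ≤ 2 * ((n : ℝ) ^ (ζ - 1) / γ₀) *
        √(∫ W, ‖θstar W‖ ^ 4 ∂(gaussianWeights m d)) := by
  obtain ⟨D, hD, hDint⟩ := exists_lintegral_exp_weightNorm_le
  set B := C * (Real.log 5 + Real.log D) with hB
  -- In `G²` the tilt contributes `exp(-2nT)`. The summands of `2T` pay for the constant part of
  -- `R`, for `5^d D^m ≤ exp(nB)`, and for a remaining decay `exp(-2n)`.
  set T := (c / 25 + B + 2) / 2 with hTdef
  set A := 2 * σ 0 ^ 2 + 2 * (L : ℝ) ^ 2 * C + 1 with hA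
  have hlogD : 0 ≤ Real.log D := Real.log_nonneg hD
  have hlog5 : 0 ≤ Real.log 5 := Real.log_nonneg (by norm_num)
  have hB0 : 0 ≤ B := by positivity
  have hT : 0 ≤ T := by positivity
  have hA0 : 0 < A := by positivity
  -- Chosen so that, using `c n ≤ m`, the `W`-dependent part of the exponent of `G²` is at most
  -- `‖W‖²/25`.
  refine ⟨c / (25 * (2 * (3 + T) * A)), by positivity, ?_⟩
  intro n m d hn ρ _ h ζ hζ γ₀ hγ hγ1 θstar hθ
  obtain ⟨_, hd, hm⟩ := h.constants_pos hc hn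
  have hn0 : (0 : ℝ) < n := by exact_mod_cast hn
  have hσ := hL.continuous
  let R : (Fin m → Fin d → ℝ) → ℝ := fun W => A * (1 + weightNorm W ^ 2 / m)
  have hR0 : ∀ W, 0 ≤ R W := fun W => by positivity
  have hR : ∀ W, ∀ᵐ x ∂ρ.fst, ‖featureMap σ W x‖ ^ 2 ≤ R W := by
    intro W
    filter_upwards [h.norm_upper] with x hx
    refine (norm_featureMap_sq_le hL hm hd W hx).trans ?_
    have hw : 0 ≤ weightNorm W ^ 2 / m := by positivity
    have h1 : 0 ≤ 2 * (L : ℝ) ^ 2 * C := by positivity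
    have h2 : 0 ≤ (2 * σ 0 ^ 2 + 1) * (weightNorm W ^ 2 / m) := by positivity
    simp only [R, hA]
    nlinarith
  have hwc := continuous_weightNorm (m := m) (d := d)
  let G : (Fin m → Fin d → ℝ) → ℝ := fun W =>
    Real.exp (n * ((3 + T) * (γ₀ * R W) - T)) / γ₀
  have hG0 : ∀ W, 0 ≤ G W := fun W => by positivity
  have hGc : Continuous G := by
    simp only [G, R]
    fun_prop
  have hG2 : ∀ W, G W ^ 2 ≤
      Real.exp (-(n * (B + 2))) / γ₀ ^ 2 * Real.exp (weightNorm W ^ 2 / 25) := by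
    intro W
    simp only [G]
    rw [div_pow, ← Real.exp_nat_mul, div_mul_eq_mul_div, ← Real.exp_add]
    gcongr ?_ / _
    rw [Real.exp_le_exp]
    have h1 : γ₀ * (2 * (3 + T) * A) ≤ c / 25 := by
      rw [le_div_iff₀ (by positivity)] at hγ1
      linarith
    have h2 : n * (γ₀ * (2 * (3 + T) * A)) * (1 + weightNorm W ^ 2 / m) ≤
        n * (c / 25) * (1 + weightNorm W ^ 2 / m) := by gcongr
    have h3 : c * n * (weightNorm W ^ 2 / m) ≤ weightNorm W ^ 2 := by
      calc _ ≤ m * (weightNorm W ^ 2 / m) := by gcongr; exact h.features_lower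
        _ = _ := by field_simp
    have h4 : (n : ℝ) * (2 * T) = n * (c / 25 + B + 2) := by rw [hTdef]; ring
    simp only [R]
    push_cast
    linarith
  obtain ⟨hexp, hexp'⟩ := integrable_exp_weightNorm_and_integral_le hD (hDint m d)
  have hGint : Integrable (fun W => G W ^ 2) (gaussianWeights m d) :=
    (hexp.const_mul _).mono' (hGc.pow 2).aestronglyMeasurable
      (Filter.Eventually.of_forall fun W => by
        rw [Real.norm_of_nonneg (sq_nonneg _)]; exact hG2 W)
  set k := (n : ℝ) ^ (ζ - 1) / γ₀ with hk
  have hk0 : 0 ≤ k := by positivity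
  have hGk : ∫ W, G W ^ 2 ∂(gaussianWeights m d) ≤ k ^ 2 := by
    have h5 : (5 : ℝ) ^ d * D ^ m ≤ Real.exp (n * B) := by
      rw [← Real.exp_log (show (0 : ℝ) < 5 by norm_num),
        ← Real.exp_log (show (0 : ℝ) < D by linarith), ← Real.exp_nat_mul, ← Real.exp_nat_mul,
        ← Real.exp_add, Real.exp_le_exp, hB]
      nlinarith [mul_le_mul_of_nonneg_right h.dim_upper hlog5,
        mul_le_mul_of_nonneg_right h.features_upper hlogD]
    have h6 : Real.exp (-(n : ℝ)) ≤ (n : ℝ) ^ (ζ - 1) := by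
      calc Real.exp (-(n : ℝ)) ≤ (n : ℝ)⁻¹ := by
            rw [Real.exp_neg]
            gcongr
            linarith [Real.add_one_le_exp (n : ℝ)]
        _ = (n : ℝ) ^ (-1 : ℝ) := (Real.rpow_neg_one _).symm
        _ ≤ _ := Real.rpow_le_rpow_of_exponent_le (by exact_mod_cast hn) (by linarith)
    calc _ ≤ ∫ W, Real.exp (-(n * (B + 2))) / γ₀ ^ 2 * Real.exp (weightNorm W ^ 2 / 25)
          ∂(gaussianWeights m d) := integral_mono hGint (hexp.const_mul _) hG2
      _ ≤ Real.exp (-(n * (B + 2))) / γ₀ ^ 2 * Real.exp (n * B) := by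
          rw [integral_const_mul]
          gcongr
          exact hexp'.trans h5
      _ = (Real.exp (-(n : ℝ)) / γ₀) ^ 2 := by
          rw [div_pow, ← Real.exp_nat_mul, div_mul_eq_mul_div, ← Real.exp_add]
          congr 2; push_cast; ring
      _ ≤ k ^ 2 := by rw [hk]; gcongr
  have hGL : MemLp G 2 (gaussianWeights m d) :=
    (memLp_two_iff_integrable_sq hGc.aestronglyMeasurable).2 hGint
  have hkG : MemLp (fun W => k + G W) 2 (gaussianWeights m d) := (memLp_const k).add hGL
  have hθ4 : Integrable (fun W => ‖θstar W‖ ^ 4) (gaussianWeights m d) := by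
    have := hθ.integrable_norm_pow (p := 4) (by norm_num)
    exact this
  have hθ2 : MemLp (fun W => ‖θstar W‖ ^ 2) 2 (gaussianWeights m d) := by
    refine (memLp_two_iff_integrable_sq (hθ.1.norm.pow 2)).2 ?_
    refine hθ4.congr (Filter.Eventually.of_forall fun W => ?_)
    simp only [Pi.pow_apply]; ring
  have hdom : Integrable (fun W => (k + G W) * ‖θstar W‖ ^ 2) (gaussianWeights m d) :=
    hkG.integrable_mul hθ2
  -- The factor `exp(nT)` undoes the tilt, so this dominates the crude exponential bound for all
  -- `W`, stable or not.
  have hGdom : Integrable (fun W => Real.exp (n * T) * (G W * ‖θstar W‖ ^ 2))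
      (gaussianWeights m d) := (hGL.integrable_mul hθ2).const_mul _
  have hint : Integrable (biasLoss (n := n) σ ρ γ₀ ζ θstar) (jointLaw n m ρ) := by
    refine Integrable.mono' (hGdom.comp_fst (Measure.pi fun _ : Fin n => ρ))
      (aestronglyMeasurable_biasLoss hσ hθ.1) ?_
    have hx : ∀ᵐ z ∂(Measure.pi fun _ : Fin n => ρ), ∀ i, ‖(z i).1‖ ^ 2 ≤ C * d :=
      ae_pi_of_ae_fst h.norm_upper
    filter_upwards [Measure.quasiMeasurePreserving_snd.ae hx] with p hp
    have hz : ∀ i, ‖featureMap σ p.1 (p.2 i).1‖ ^ 2 ≤ R p.1 := by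
      intro i
      refine (norm_featureMap_sq_le hL hm hd p.1 (hp i)).trans ?_
      have hw : 0 ≤ weightNorm p.1 ^ 2 / m := by positivity
      have h1 : 0 ≤ 2 * (L : ℝ) ^ 2 * C := by positivity
      have h2 : 0 ≤ (2 * σ 0 ^ 2 + 1) * (weightNorm p.1 ^ 2 / m) := by positivity
      simp only [R, hA]
      nlinarith
    rw [Real.norm_of_nonneg (biasLoss_nonneg hσ (hR p.1) p.2)]
    refine (biasLoss_le_exp hσ hn hγ hζ (hR0 p.1) (hR p.1) hz).trans ?_
    refine (mul_le_mul_of_nonneg_right ?_ (sq_nonneg _)).trans_eq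
      (mul_assoc (Real.exp (n * T)) (G p.1) _)
    simp only [G]
    rw [← mul_div_assoc, ← Real.exp_add]
    gcongr ?_ / _
    rw [Real.exp_le_exp]
    have : 0 ≤ n * (T * (γ₀ * R p.1)) := by have := hR0 p.1; positivity
    linarith
  refine ⟨hint, ?_⟩
  have hsq : √(∫ W, (k + G W) ^ 2 ∂(gaussianWeights m d)) ≤ 2 * k := by
    rw [Real.sqrt_le_left (by positivity)]
    calc _ ≤ ∫ W, (2 * k ^ 2 + 2 * G W ^ 2) ∂(gaussianWeights m d) := by
          refine integral_mono hkG.integrable_sq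
            ((integrable_const _).add (hGint.const_mul _)) fun W => ?_
          simp only
          nlinarith [sq_nonneg (k - G W)]
      _ = 2 * k ^ 2 + 2 * ∫ W, G W ^ 2 ∂(gaussianWeights m d) := by
          rw [integral_add (integrable_const _) (hGint.const_mul _), integral_const,
            integral_const_mul, probReal_univ, one_smul]
      _ ≤ _ := by linarith
  calc bias n σ ρ γ₀ ζ θstar = ∫ W, ∫ z, biasLoss (n := n) σ ρ γ₀ ζ θstar (W, z)
        ∂(Measure.pi fun _ => ρ) ∂(gaussianWeights m d) := integral_prod _ hint
    _ ≤ ∫ W, (k + G W) * ‖θstar W‖ ^ 2 ∂(gaussianWeights m d) :=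
        integral_mono hint.integral_prod_left hdom fun W =>
          integral_biasLoss_le hσ hn hγ hζ (hR0 W) (hR W) hT
    _ ≤ √(∫ W, (k + G W) ^ 2 ∂(gaussianWeights m d)) *
          √(∫ W, (‖θstar W‖ ^ 2) ^ 2 ∂(gaussianWeights m d)) :=
        integral_mul_le_sqrt_mul_sqrt (fun W => add_nonneg hk0 (hG0 W))
          (fun W => sq_nonneg _) hkG hθ2
    _ ≤ _ := by
        simp only [← pow_mul]
        gcongr

/-! ### Assembly of the theorem. -/

theorem biasLoss_zero {n m d : ℕ} (ρ : Measure (EuclideanSpace ℝ (Fin d) × ℝ)) (γ₀ ζ : ℝ)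
    (θstar : (Fin m → Fin d → ℝ) → EuclideanSpace ℝ (Fin m)) :
    biasLoss (n := n) 0 ρ γ₀ ζ θstar = 0 := by
  ext p
  have h : featureCov 0 ρ p.1 = 0 := by
    ext i j
    simp [featureCov, featureOuter, featureMap]
  simp [biasLoss, h]

theorem theorem1 (σ : ℝ → ℝ) (hσ : ∃ L, LipschitzWith L σ) (c C : ℝ) (hc : 0 < c) :
    (σ ≠ 0 → ∃ a b : ℝ, 0 < a ∧ 0 < b ∧
      ∀ (n m d : ℕ) (_ : 1 ≤ n) (ρ : Measure (EuclideanSpace ℝ (Fin d) × ℝ))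
        (_ : IsProbabilityMeasure ρ), HighDimensional c C n m d ρ →
        a ≤ (expectedFeatureCov σ ρ m).trace ∧ (expectedFeatureCov σ ρ m).trace ≤ b) ∧
    ∃ c₀ : ℝ, 0 < c₀ ∧ ∀ g : ℝ, 0 < g → ∃ K : ℝ, 0 < K ∧
      ∀ (n m d : ℕ) (_ : 1 ≤ n) (ρ : Measure (EuclideanSpace ℝ (Fin d) × ℝ))
        (_ : IsProbabilityMeasure ρ) (_ : MemLp (fun z => z.2) 2 ρ)
        (_ : HighDimensional c C n m d ρ)
        (r' r : ℝ) (_ : FourthMomentCondition σ ρ m r' r)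
        (ζ : ℝ) (_ : 0 ≤ ζ) (_ : ζ < 1)
        (γ₀ : ℝ) (_ : g ≤ γ₀) (_ : γ₀ * (r' * (expectedFeatureCov σ ρ m).trace) ≤ c₀)
        (θstar : (Fin m → Fin d → ℝ) → EuclideanSpace ℝ (Fin m))
        (_ : ∀ᵐ W ∂(gaussianWeights m d), IsOptimal σ ρ W (θstar W))
        (_ : MemLp θstar 4 (gaussianWeights m d)),
        Integrable (biasLoss (n := n) σ ρ γ₀ ζ θstar) (jointLaw n m ρ) ∧
        bias n σ ρ γ₀ ζ θstar ≤ K * γ₀ * r' * (n : ℝ) ^ (ζ - 1) *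
          √(∫ W, ‖θstar W‖ ^ 4 ∂(gaussianWeights m d)) ∧
        bias n σ ρ γ₀ ζ θstar ≤ K * (n : ℝ) ^ (ζ - 1) *
          √(∫ W, ‖θstar W‖ ^ 4 ∂(gaussianWeights m d)) := by
  obtain ⟨L, hL⟩ := hσ
  refine ⟨fun hσ0 => ?_, ?_⟩
  · obtain ⟨a, ha, ha'⟩ := exists_le_trace_expectedFeatureCov hL hσ0 hc C
    refine ⟨a, max 1 (2 * σ 0 ^ 2 + 2 * (L : ℝ) ^ 2 * (∫ z, z ^ 2 ∂(gaussianReal 0 1)) * C), ha,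
      lt_max_of_lt_left one_pos, fun n m d hn ρ hρ h => ⟨ha' n m d hn ρ hρ h, ?_⟩⟩
    exact (h.trace_le hL hc hn).trans (le_max_right _ _)
  rcases le_or_gt C 0 with hC | hC
  · exact ⟨1, one_pos, fun g _ => ⟨1, one_pos, fun n m d hn ρ _ _ h =>
      absurd (h.constants_pos hc hn).1 hC.not_gt⟩⟩
  -- For `σ = 0` the trace vanishes and the step-size condition does not bound `γ₀`, but the loss is
  -- identically zero.
  by_cases hσ0 : σ = 0
  · subst hσ0
    refine ⟨1, one_pos, fun g hg => ⟨1, one_pos, ?_⟩⟩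
    intro n m d hn ρ _ _ _ r' r hF ζ _ _ γ₀ hγ _ θstar _ _
    have hγ0 : 0 < γ₀ := hg.trans_le hγ
    have hr : 0 < r' := one_pos.trans_le hF.one_le_r'
    simp only [bias, biasLoss_zero, Pi.zero_apply, integral_zero]
    exact ⟨integrable_zero _ _ _, by positivity, by positivity⟩
  obtain ⟨a, ha, ha'⟩ := exists_le_trace_expectedFeatureCov hL hσ0 hc C
  obtain ⟨c₁, hc₁, hbound⟩ := exists_stepSize_bound hL hc hC
  -- With `r' ≥ 1` and trace at least `a`, the threshold `c₁ * a` forces `γ₀ ≤ c₁`. In `K`, the term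
  -- `2/g` serves the bound without `γ₀ r'`; the term `2/g²` serves the other, since `γ₀ r' ≥ g`.
  refine ⟨c₁ * a, by positivity, fun g hg => ⟨2 / g + 2 / g ^ 2, by positivity, ?_⟩⟩
  intro n m d hn ρ hρ _ h r' r hF ζ hζ _ γ₀ hγ hγ1 θstar _ hθ
  have hγ0 : 0 < γ₀ := hg.trans_le hγ
  have hr := hF.one_le_r'
  have htr := ha' n m d hn ρ hρ h
  have hγc : γ₀ ≤ c₁ := by
    refine le_of_mul_le_mul_right (le_trans ?_ hγ1) ha
    gcongr
    nlinarith
  obtain ⟨hint, hle⟩ := hbound n m d hn ρ hρ h ζ hζ γ₀ hγ0 hγc θstar hθ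
  set N := √(∫ W, ‖θstar W‖ ^ 4 ∂(gaussianWeights m d))
  have hN : 0 ≤ N := Real.sqrt_nonneg _
  have hp : 0 < (n : ℝ) ^ (ζ - 1) :=
    Real.rpow_pos_of_pos (by exact_mod_cast hn) _
  have h1 : 2 * ((n : ℝ) ^ (ζ - 1) / γ₀) * N ≤ 2 / g * (n : ℝ) ^ (ζ - 1) * N := by
    calc _ = 2 / γ₀ * (n : ℝ) ^ (ζ - 1) * N := by ring
      _ ≤ _ := by gcongr
  have h2 : 2 / g ≤ 2 / g ^ 2 * γ₀ * r' := by
    calc 2 / g = 2 / g ^ 2 * g * 1 := by field_simp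
      _ ≤ _ := by gcongr
  refine ⟨hint, hle.trans (h1.trans ?_), hle.trans (h1.trans ?_)⟩
  · have h3 : 0 ≤ 2 / g * γ₀ * r' := by positivity
    gcongr
    linarith
  · have h3 : 0 ≤ 2 / g ^ 2 := by positivity
    gcongr
    linarith
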